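/- **Setting.** Let $(G_n)_{n\in\mathbb N}$ be a direct system of connected finite-dimensional real Lie groups (for instance compact connected ones) and smooth homomorphisms, and let $G=\varinjlim G_n$ as a group. For each $n$ fix a Cartan subalgebra $\mathfrak h_n$ of the complexified Lie algebra $(\mathfrak g_n)_{\mathbb C}$ and a system of positive roots $\Sigma_n^+$, consisting of the roots on which a fixed real-linear functional on $\mathfrak h_n^*$, nonvanishing on every root, is positive. No compatibility between these choices for different $n$ is required. A representation of a Lie group on a complex vector space is understood to be smooth: all its matrix coefficients are smooth functions. A *highest weight vector* of a representation of $G_n$ is a nonzero vector that is annihilated by the root spaces of all $\alpha\in\Sigma_n^+$ and on which $\mathfrak h_n$ acts by scalars, through a linear functional. An *irreducible highest weight representation* of $G_n$ is a finite-dimensional irreducible representation that has a highest weight vector. A representation is a *multiplicity free direct sum* of representations of some kind if its space is the algebraic direct sum of pairwise inequivalent subrepresentations of that kind. Let $\pi_n$ be representations of $G_n$ on complex vector spaces $V_n$, where the $V_n$ form a direct system with injective transition maps $V_m\hookrightarrow V_n$ ($m\le n$) that are equivariant with respect to $G_m\to G_n$. Then $\pi=\varinjlim\pi_n$ is the representation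 of $G$ on $V=\varinjlim V_n$ given by $\pi([g])[v]=[\pi_n(g)v]$ for $g\in G_n$, $v\in V_n$. A representation of $G$ is *lim-irreducible* if it is equivalent to $\varinjlim\sigma_n$ for such a system of representations $\sigma_n$ in which every $\sigma_n$ is an irreducible representation of $G_n$. **Theorem.** Let $\pi=\varinjlim\pi_n$ be as above, and suppose that each $\pi_n$ is a multiplicity free direct sum of irreducible highest weight representations of $G_n$. Suppose that, for all sufficiently large $n$, the map $V_{n-1}\hookrightarrow V_n$ sends $G_{n-1}$-highest weight vectors to $G_n$-highest weight vectors. Then $\pi$ is a multiplicity free direct sum of lim-irreducible representations of $G$. -/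

import Mathlib

open scoped Manifold ContDiff TensorProduct

universe uG uE uV uW

noncomputable section

/-! ### Lie groups, smooth representations, highest weight vectors -/

section HighestWeight

variable (E : Type uE) [NormedAddCommGroup E] [NormedSpace ℝ E] [FiniteDimensional ℝ E]
  (G : Type uG) [Group G] [TopologicalSpace G] [ChartedSpace E G] [LieGroup 𝓘(ℝ, E) ∞ G]

instance lieGroup_minSmoothness_three : LieGroup 𝓘(ℝ, E) (minSmoothness ℝ 3) G :=
  LieGroup.of_le (n := ∞) (by simpa using (WithTop.coe_le_coe.2 le_top : ((3 : ℕ∞) : ℕ∞ω) ≤ ∞))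

/-- The complexified Lie algebra `𝔤_ℂ = ℂ ⊗ 𝔤` of a real Lie group `G`. -/
abbrev ComplexLieAlgebra : Type uE := ℂ ⊗[ℝ] (GroupLieAlgebra 𝓘(ℝ, E) G)

/-- The choices with respect to which highest weights of representations of a Lie group `G` are
taken: a Cartan subalgebra `𝔥` of `𝔤_ℂ`, and a system of positive roots, namely those roots on
which a given regular real linear functional on `𝔥*` (one which does not vanish on any root) is
positive. -/
structure PositiveRootData where
  cartan : LieSubalgebra ℂ (ComplexLieAlgebra E G)
  isCartan : cartan.IsCartanSubalgebra
  order : Module.Dual ℂ cartan →ₗ[ℝ] ℝ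
  regular : ∀ α : Module.Dual ℂ cartan, α ≠ 0 →
    LieAlgebra.rootSpace cartan (α : cartan → ℂ) ≠ ⊥ → order α ≠ 0

attribute [instance] PositiveRootData.isCartan

variable {E G} {V : Type uV} [AddCommGroup V] [Module ℂ V]

variable (E) in
/-- A representation of a Lie group on a complex vector space is smooth if all its matrix
coefficients `g ↦ ℓ (π g v)` are smooth functions. -/
def IsSmoothRep (π : Representation ℂ G V) : Prop :=
  ∀ (v : V) (ℓ : Module.Dual ℂ V), ContMDiff 𝓘(ℝ, E) 𝓘(ℝ, ℂ) ∞ fun g : G => ℓ (π g v)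

variable (E) in
/-- The complex linear extension to `𝔤_ℂ` of the differential at `1` of the matrix coefficient
`g ↦ ℓ (π g v)`; that is, `X ↦ ℓ (dπ(X) v)`. -/
def diffCoeff (π : Representation ℂ G V) (v : V) (ℓ : Module.Dual ℂ V) :
    ComplexLieAlgebra E G →ₗ[ℂ] ℂ :=
  LinearMap.liftBaseChange ℂ
    (show GroupLieAlgebra 𝓘(ℝ, E) G →ₗ[ℝ] ℂ from
      (mfderiv 𝓘(ℝ, E) 𝓘(ℝ, ℂ) (fun g : G => ℓ (π g v)) 1).toLinearMap)

variable (E) in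
/-- `dπ(X) v = w`, for `X` in the complexified Lie algebra. -/
def DerivedActionEq (π : Representation ℂ G V) (X : ComplexLieAlgebra E G) (v w : V) : Prop :=
  ∀ ℓ : Module.Dual ℂ V, diffCoeff E π v ℓ X = ℓ w

/-- `v` is a highest weight vector of `π`: it is nonzero, it is annihilated by the root spaces of
all positive roots, and the Cartan subalgebra acts on it through a linear functional. -/
def IsHighestWeightVector (P : PositiveRootData E G) (π : Representation ℂ G V) (v : V) : Prop :=
  v ≠ 0 ∧
  (∀ α : Module.Dual ℂ P.cartan, 0 < P.order α →
    ∀ X ∈ LieAlgebra.rootSpace P.cartan (α : P.cartan → ℂ), DerivedActionEq E π X v 0) ∧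
  ∃ wt : Module.Dual ℂ P.cartan, ∀ H : P.cartan,
    DerivedActionEq E π (H : ComplexLieAlgebra E G) v (wt H • v)

/-- `π` is an irreducible highest weight representation: smooth, finite dimensional, irreducible,
and having a highest weight vector (which then generates it). -/
def IsIrreducibleHighestWeightRep (P : PositiveRootData E G) (π : Representation ℂ G V) : Prop :=
  IsSmoothRep E π ∧ FiniteDimensional ℂ V ∧ π.IsIrreducible ∧ ∃ v, IsHighestWeightVector P π v

end HighestWeight

/-! ### Multiplicity free direct sums -/

/-- `π` is a multiplicity free (algebraic) direct sum of subrepresentations with the property `Q`,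
a property that is meant to imply irreducibility: the representation space is the internal direct
sum of pairwise inequivalent subrepresentations with the property `Q`. -/
def IsMultiplicityFreeSum {G : Type uG} [Group G] {V : Type uV} [AddCommGroup V] [Module ℂ V]
    (π : Representation ℂ G V)
    (Q : ∀ {W : Type uV} [AddCommGroup W] [Module ℂ W], Representation ℂ G W → Prop) : Prop :=
  ∃ (ι : Type uV) (_ : DecidableEq ι) (W : ι → Subrepresentation π),
    DirectSum.IsInternal (fun i => (W i).toSubmodule) ∧
    (∀ i, Q (W i).toRepresentation) ∧
    Pairwise fun i j => IsEmpty ((W i).toRepresentation.Equiv (W j).toRepresentation)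

/-! ### Direct systems of representations and their limits -/

section Limit

variable {E : ℕ → Type uE} [∀ n, NormedAddCommGroup (E n)] [∀ n, NormedSpace ℝ (E n)]
  {G : ℕ → Type uG} [∀ n, Group (G n)] [∀ n, TopologicalSpace (G n)]
  [∀ n, ChartedSpace (E n) (G n)]

variable (E) in
/-- A direct system of smooth representations `rho n` of the groups `G n` on complex vector spaces
`V n`, with injective equivariant transition maps, over the direct system of groups with transition
maps `φ`. -/
structure RepSystem (φ : ∀ i j : ℕ, i ≤ j → G i →* G j) where
  V : ℕ → Type uV
  [addCommGroup : ∀ n, AddCommGroup (V n)]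
  [module : ∀ n, Module ℂ (V n)]
  rho : ∀ n, Representation ℂ (G n) (V n)
  smooth : ∀ n, IsSmoothRep (E n) (rho n)
  map : ∀ i j : ℕ, i ≤ j → V i →ₗ[ℂ] V j
  [directed : DirectedSystem V (map · · ·)]
  injective : ∀ i j h, Function.Injective (map i j h)
  equivariant : ∀ i j h (g : G i) (v : V i),
    map i j h (rho i g v) = rho j (φ i j h g) (map i j h v)

attribute [instance] RepSystem.addCommGroup RepSystem.module RepSystem.directed

variable {φ : ∀ i j : ℕ, i ≤ j → G i →* G j} [DirectedSystem G (φ · · ·)]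

namespace RepSystem

/-- The representation space `lim V n`. -/
abbrev Space (S : RepSystem.{uG, uE, uV} E φ) : Type uV := DirectLimit S.V S.map

/-- The action of `lim G n` on `lim V n`: it sends `[g], [v]` to `[π n g v]` for `g ∈ G n`,
`v ∈ V n`. -/
def limitAct (S : RepSystem.{uG, uE, uV} E φ) : DirectLimit G φ → S.Space → S.Space :=
  DirectLimit.map₂ φ S.map S.map (fun n g v => S.rho n g v)
    (fun i j h g v => S.equivariant i j h g v)

theorem limitAct_mk (S : RepSystem.{uG, uE, uV} E φ) (n : ℕ) (g : G n) (v : S.V n) :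
    S.limitAct ⟦⟨n, g⟩⟧ ⟦⟨n, v⟩⟧ = ⟦⟨n, S.rho n g v⟩⟧ :=
  DirectLimit.map₂_def ..

theorem exists_common_index₃ (S : RepSystem.{uG, uE, uV} E φ) (g : DirectLimit G φ)
    (v w : S.Space) : ∃ (n : ℕ) (a : G n) (x y : S.V n),
      g = ⟦⟨n, a⟩⟧ ∧ v = ⟦⟨n, x⟩⟧ ∧ w = ⟦⟨n, y⟩⟧ := by
  obtain ⟨i, a, rfl⟩ := DirectLimit.exists_eq_mk φ g
  obtain ⟨j, x, y, rfl, rfl⟩ := DirectLimit.exists_eq_mk₂ S.map v w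
  exact ⟨max i j, φ i _ (le_max_left i j) a, S.map j _ (le_max_right i j) x,
    S.map j _ (le_max_right i j) y, (DirectLimit.mk_apply i _ a _).symm,
    (DirectLimit.mk_apply j _ x _).symm, (DirectLimit.mk_apply j _ y _).symm⟩

theorem exists_common_index₂ (S : RepSystem.{uG, uE, uV} E φ) (g h : DirectLimit G φ)
    (v : S.Space) : ∃ (n : ℕ) (a b : G n) (x : S.V n),
      g = ⟦⟨n, a⟩⟧ ∧ h = ⟦⟨n, b⟩⟧ ∧ v = ⟦⟨n, x⟩⟧ := by
  obtain ⟨i, a, b, rfl, rfl⟩ := DirectLimit.exists_eq_mk₂ φ g h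
  obtain ⟨j, x, rfl⟩ := DirectLimit.exists_eq_mk S.map v
  exact ⟨max i j, φ i _ (le_max_left i j) a, φ i _ (le_max_left i j) b,
    S.map j _ (le_max_right i j) x, (DirectLimit.mk_apply i _ a _).symm,
    (DirectLimit.mk_apply i _ b _).symm, (DirectLimit.mk_apply j _ x _).symm⟩

/-- The representation `lim π n` of the group `lim G n` on `lim V n`. -/
def limitRep (S : RepSystem.{uG, uE, uV} E φ) : Representation ℂ (DirectLimit G φ) S.Space where
  toFun g :=
    { toFun := S.limitAct g
      map_add' := by
        intro v w
        obtain ⟨n, a, x, y, rfl, rfl, rfl⟩ := S.exists_common_index₃ g v w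
        simp only [DirectLimit.add_def, limitAct_mk, map_add]
      map_smul' := by
        intro c v
        obtain ⟨n, a, x, _, rfl, rfl, -⟩ := S.exists_common_index₃ g v v
        simp only [DirectLimit.smul_def, limitAct_mk, map_smul, RingHom.id_apply] }
  map_one' := by
    refine LinearMap.ext fun v => ?_
    obtain ⟨n, x, rfl⟩ := DirectLimit.exists_eq_mk S.map v
    simp only [DirectLimit.one_def n, LinearMap.coe_mk, AddHom.coe_mk, limitAct_mk, map_one,
      Module.End.one_apply]
  map_mul' g h := by
    refine LinearMap.ext fun v => ?_
    obtain ⟨n, a, b, x, rfl, rfl, rfl⟩ := S.exists_common_index₂ g h v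
    simp only [DirectLimit.mul_def, LinearMap.coe_mk, AddHom.coe_mk, limitAct_mk, map_mul,
      Module.End.mul_apply]

theorem limitRep_mk (S : RepSystem.{uG, uE, uV} E φ) (n : ℕ) (g : G n) (v : S.V n) :
    S.limitRep ⟦⟨n, g⟩⟧ ⟦⟨n, v⟩⟧ = ⟦⟨n, S.rho n g v⟩⟧ :=
  S.limitAct_mk n g v

end RepSystem

/-- A representation of `lim G n` is lim-irreducible if it is (equivalent to) `lim σ n` for some
direct system of irreducible representations `σ n` of the `G n`. -/
def IsLimIrreducible (E : ℕ → Type uE) [∀ n, NormedAddCommGroup (E n)] [∀ n, NormedSpace ℝ (E n)]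
    [∀ n, ChartedSpace (E n) (G n)] {W : Type uW} [AddCommGroup W] [Module ℂ W]
    (σ : Representation ℂ (DirectLimit G φ) W) : Prop :=
  ∃ S : RepSystem.{uG, uE, uW} E φ,
    (∀ n, (S.rho n).IsIrreducible) ∧ Nonempty (σ.Equiv S.limitRep)

end Limit

end

/-! The core fact is that a highest weight vector `w` of a multiplicity free sum of
finite-dimensional irreducibles lies in a single summand
(`IsHighestWeightVector.exists_mem_summand`). Let `M` be the 𝔤_ℂ-submodule generated by `w` inside a
finite subsum. The vectors of `M` with the weight of `w` are multiples of `w`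
(`mem_span_singleton_of_mem_lieSpan_highestWeightVector`), and `M` is a subrepresentation because
the group is connected (`apply_mem_of_derivedVec_mem`). Multiplicity freeness puts every component
of `w` in `M` (`component_mem_of_mem`). A component has the weight of `w`, hence is a multiple of
`w`, and a nonzero one places `w` in its summand.

So for large `n` each irreducible summand of `V n`, having its highest weight vector sent into one
summand of `V (n + 1)`, is sent there as a whole. The summands form a forest in which each has one
successor; branches that eventually meet have the same union, and these unions are lim-irreducible
(`isMultiplicityFreeSum_of_summands_le`). A finite linear relation between unions lives at one
level, so they are independent. An equivalence of two unions gives a nonzero intertwiner between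
summands of one level, so by Schur's lemma and multiplicity freeness the two branches meet.

The derived representation is built from matrix coefficients: its bracket relation comes from
left-invariant vector fields, and stability under the group from a linear differential equation. -/

noncomputable section

/-! ### Lie brackets of vector fields as commutators of derivations -/

section Bracket

open VectorField Filter Topology

variable {E : Type*} [NormedAddCommGroup E] [NormedSpace ℝ E]
  {M : Type*} [TopologicalSpace M] [ChartedSpace E M] [IsManifold 𝓘(ℝ, E) ∞ M]
  {F : Type*} [NormedAddCommGroup F] [NormedSpace ℝ F]

/-- The derivative of a vector valued function on a manifold along a tangent vector. -/
def dirDeriv (f : M → F) (z : M) (v : TangentSpace 𝓘(ℝ, E) z) : F :=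
  mfderiv 𝓘(ℝ, E) 𝓘(ℝ, F) f z v

/-- Pulling back inverts the differential of the inverse chart, and the chain rule applies it again,
so the two cancel. -/
theorem fderiv_comp_extChartAt_symm_apply_mpullbackWithin {x : M} {y : E}
    (hy : y ∈ (extChartAt 𝓘(ℝ, E) x).target) {g : M → F}
    (hg : MDifferentiableAt 𝓘(ℝ, E) 𝓘(ℝ, F) g ((extChartAt 𝓘(ℝ, E) x).symm y))
    (V : Π z : M, TangentSpace 𝓘(ℝ, E) z) :
    fderiv ℝ (g ∘ (extChartAt 𝓘(ℝ, E) x).symm) y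
      (mpullbackWithin 𝓘(ℝ, E) 𝓘(ℝ, E) (extChartAt 𝓘(ℝ, E) x).symm V (Set.range 𝓘(ℝ, E)) y) =
    dirDeriv g ((extChartAt 𝓘(ℝ, E) x).symm y) (V ((extChartAt 𝓘(ℝ, E) x).symm y)) := by
  have : IsManifold 𝓘(ℝ, E) 1 M := .of_le (n := ∞) (by simp)
  have hinv := isInvertible_mfderivWithin_extChartAt_symm (I := 𝓘(ℝ, E)) hy
  have hd := mdifferentiableWithinAt_extChartAt_symm (I := 𝓘(ℝ, E)) hy
  rw [mpullbackWithin_apply]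
  simp only [modelWithCornersSelf_coe, Set.range_id, mfderivWithin_univ,
    mdifferentiableWithinAt_univ] at *
  have hc := mfderiv_comp (I' := 𝓘(ℝ, E)) _ hg hd
  obtain ⟨e, he⟩ := hinv
  rw [← he, ContinuousLinearMap.inverse_equiv]
  rw [← he] at hc
  rw [← mfderiv_eq_fderiv]
  refine (DFunLike.congr_fun hc _).trans ?_
  exact congrArg (mfderiv 𝓘(ℝ, E) 𝓘(ℝ, F) g ((extChartAt 𝓘(ℝ, E) x).symm y))
    (e.apply_symm_apply _)

/-- Differentiation along the Lie bracket of two vector fields is the commutator of the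
differentiations along these fields. -/
theorem mfderiv_apply_mlieBracket [CompleteSpace E] {x : M} {f : M → F}
    (hf : ContMDiff 𝓘(ℝ, E) 𝓘(ℝ, F) ∞ f) {V W : Π z : M, TangentSpace 𝓘(ℝ, E) z}
    (hV : MDifferentiableAt 𝓘(ℝ, E) 𝓘(ℝ, E).tangent
      (fun z => (V z : TangentBundle 𝓘(ℝ, E) M)) x)
    (hW : MDifferentiableAt 𝓘(ℝ, E) 𝓘(ℝ, E).tangent
      (fun z => (W z : TangentBundle 𝓘(ℝ, E) M)) x)
    {a b : M → F}
    (ha : ∀ z, a z = dirDeriv f z (V z))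
    (hb : ∀ z, b z = dirDeriv f z (W z))
    (hda : MDifferentiableAt 𝓘(ℝ, E) 𝓘(ℝ, F) a x)
    (hdb : MDifferentiableAt 𝓘(ℝ, E) 𝓘(ℝ, F) b x) :
    dirDeriv f x (mlieBracket 𝓘(ℝ, E) V W x) = dirDeriv b x (V x) - dirDeriv a x (W x) := by
  have : IsManifold 𝓘(ℝ, E) 1 M := .of_le (n := ∞) (by simp)
  have : IsManifold 𝓘(ℝ, E) 2 M := .of_le (n := ∞) (by simpa using (WithTop.coe_le_coe.2 le_top : ((2 : ℕ∞) : ℕ∞ω) ≤ ∞))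
  set φ := extChartAt 𝓘(ℝ, E) x with hφ
  have hxt : φ x ∈ φ.target := mem_extChartAt_target x
  have hinv := isInvertible_mfderiv_extChartAt (I := 𝓘(ℝ, E)) (mem_extChartAt_source (I := 𝓘(ℝ, E)) x)
  have hV' := hV.mdifferentiableWithinAt (s := Set.univ)
    |>.differentiableWithinAt_mpullbackWithin_vectorField
  have hW' := hW.mdifferentiableWithinAt (s := Set.univ)
    |>.differentiableWithinAt_mpullbackWithin_vectorField
  have hfd : MDifferentiable 𝓘(ℝ, E) 𝓘(ℝ, F) f := hf.mdifferentiable (by simp)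
  have hh : ContDiffAt ℝ ∞ (f ∘ φ.symm) (φ x) := by
    rw [← contMDiffAt_iff_contDiffAt]
    refine hf.contMDiffAt.comp _ ?_
    exact (contMDiffOn_extChartAt_symm x).contMDiffAt (extChartAt_target_mem_nhds x)
  have hfx : mfderiv 𝓘(ℝ, E) 𝓘(ℝ, F) ((f ∘ φ.symm) ∘ φ) x =
      mfderiv 𝓘(ℝ, E) 𝓘(ℝ, F) f x := by
    refine Filter.EventuallyEq.mfderiv_eq ?_
    filter_upwards [extChartAt_source_mem_nhds (I := 𝓘(ℝ, E)) x] with z hz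
    simp only [hφ, Function.comp_apply, (extChartAt 𝓘(ℝ, E) x).left_inv hz]
  have hcomp := mfderiv_comp (I' := 𝓘(ℝ, E)) x
    (hh.differentiableAt (by simp)).mdifferentiableAt
    (mdifferentiableAt_extChartAt (I := 𝓘(ℝ, E)) (mem_chart_source E x))
  -- The equality holds on a whole neighbourhood, so it may be differentiated once more.
  have key : ∀ (U : Π z : M, TangentSpace 𝓘(ℝ, E) z) (c : M → F),
      (∀ z, c z = dirDeriv f z (U z)) →
      (fun y => fderiv ℝ (f ∘ φ.symm) y
        (mpullbackWithin 𝓘(ℝ, E) 𝓘(ℝ, E) φ.symm U (Set.range 𝓘(ℝ, E)) y)) =ᶠ[𝓝 (φ x)]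
      c ∘ φ.symm := by
    intro U c hc
    filter_upwards [extChartAt_target_mem_nhds (I := 𝓘(ℝ, E)) x] with y hy
    rw [fderiv_comp_extChartAt_symm_apply_mpullbackWithin hy (hfd _), Function.comp_apply, hc]
  have key2 : ∀ (U : Π z : M, TangentSpace 𝓘(ℝ, E) z) (c : M → F),
      MDifferentiableAt 𝓘(ℝ, E) 𝓘(ℝ, F) c x →
      fderiv ℝ (c ∘ φ.symm) (φ x)
        (mpullbackWithin 𝓘(ℝ, E) 𝓘(ℝ, E) φ.symm U (Set.range 𝓘(ℝ, E)) (φ x)) =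
      dirDeriv c x (U x) := by
    intro U c hc
    have hx : φ.symm (φ x) = x := extChartAt_to_inv x
    rw [fderiv_comp_extChartAt_symm_apply_mpullbackWithin hxt (by rwa [← hφ, hx]), ← hφ, hx]
  have hchain (v : TangentSpace 𝓘(ℝ, E) x) : dirDeriv f x v =
      fderiv ℝ (f ∘ φ.symm) (φ x) (mfderiv 𝓘(ℝ, E) 𝓘(ℝ, E) φ x v) := by
    rw [← mfderiv_eq_fderiv]
    exact DFunLike.congr_fun (hfx.symm.trans hcomp) v
  have hbr : mlieBracket 𝓘(ℝ, E) V W x = _ := mlieBracketWithin_apply (s := Set.univ)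
  rw [hchain, hbr]
  simp only [modelWithCornersSelf_coe, Set.range_id, Set.preimage_univ, Set.inter_univ] at *
  rw [← hφ] at *
  -- The flat case, which rests on the symmetry of the second derivative of `f` read in the chart.
  have main : ∀ V' W' : E → E, DifferentiableWithinAt ℝ V' Set.univ (φ x) →
      DifferentiableWithinAt ℝ W' Set.univ (φ x) →
      (fun y => fderiv ℝ (f ∘ φ.symm) y (V' y)) =ᶠ[𝓝 (φ x)] a ∘ φ.symm →
      (fun y => fderiv ℝ (f ∘ φ.symm) y (W' y)) =ᶠ[𝓝 (φ x)] b ∘ φ.symm →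
      fderiv ℝ (b ∘ φ.symm) (φ x) (V' (φ x)) = dirDeriv b x (V x) →
      fderiv ℝ (a ∘ φ.symm) (φ x) (W' (φ x)) = dirDeriv a x (W x) →
      fderiv ℝ (f ∘ φ.symm) (φ x) (lieBracketWithin ℝ V' W' Set.univ (φ x)) =
        dirDeriv b x (V x) - dirDeriv a x (W x) := by
    intro V' W' hV' hW' h1 h2 h3 h4
    rw [lieBracketWithin_univ]
    rw [differentiableWithinAt_univ] at hV' hW'
    rw [fderiv_apply_lieBracket hh
      (by simpa using (WithTop.coe_le_coe.2 le_top : ((2 : ℕ∞) : ℕ∞ω) ≤ ∞)) hW' hV', h1.fderiv_eq, h2.fderiv_eq, h3, h4]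
  obtain ⟨e, he⟩ := hinv
  rw [← he, ContinuousLinearMap.inverse_equiv]
  refine (congrArg (fderiv ℝ (f ∘ φ.symm) (φ x)) (e.apply_symm_apply _)).trans ?_
  exact main _ _ hV' hW' (key V a ha) (key W b hb) (key2 _ _ hdb) (key2 _ _ hda)

end Bracket

section DirDeriv

variable {E : Type*} [NormedAddCommGroup E] [NormedSpace ℝ E]
  {M : Type*} [TopologicalSpace M] [ChartedSpace E M]
  {F : Type*} [NormedAddCommGroup F] [NormedSpace ℝ F]
  {F' : Type*} [NormedAddCommGroup F'] [NormedSpace ℝ F']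

theorem dirDeriv_add {f g : M → F} {z : M} (hf : MDifferentiableAt 𝓘(ℝ, E) 𝓘(ℝ, F) f z)
    (hg : MDifferentiableAt 𝓘(ℝ, E) 𝓘(ℝ, F) g z) (v : TangentSpace 𝓘(ℝ, E) z) :
    dirDeriv (fun y => f y + g y) z v = dirDeriv f z v + dirDeriv g z v :=
  DFunLike.congr_fun (mfderiv_add hf hg) v

theorem dirDeriv_clm_comp {f : M → F} {z : M} (hf : MDifferentiableAt 𝓘(ℝ, E) 𝓘(ℝ, F) f z)
    (L : F →L[ℝ] F') (v : TangentSpace 𝓘(ℝ, E) z) :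
    dirDeriv (fun y => L (f y)) z v = L (dirDeriv f z v) := by
  have h := mfderiv_comp (I' := 𝓘(ℝ, F)) z (L.contMDiff.mdifferentiableAt one_ne_zero) hf
  refine (DFunLike.congr_fun h v).trans ?_
  rw [L.mfderiv_eq]
  rfl

theorem dirDeriv_const_mul {f : M → ℂ} {z : M} (hf : MDifferentiableAt 𝓘(ℝ, E) 𝓘(ℝ, ℂ) f z)
    (c : ℂ) (v : TangentSpace 𝓘(ℝ, E) z) :
    dirDeriv (fun y => c * f y) z v = c * dirDeriv f z v :=
  dirDeriv_clm_comp hf (ContinuousLinearMap.mul ℝ ℂ c) v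

end DirDeriv

/-! ### The derived representation of the complexified Lie algebra -/

section DerivedRep

variable {E : Type uE} [NormedAddCommGroup E] [NormedSpace ℝ E]
  {G : Type uG} [Group G] [TopologicalSpace G] [ChartedSpace E G]
  {V : Type uV} [AddCommGroup V] [Module ℂ V] {U : Type uW} [AddCommGroup U] [Module ℂ U]

theorem diffCoeff_tmul (π : Representation ℂ G V) (v : V) (ℓ : Module.Dual ℂ V) (c : ℂ)
    (X : GroupLieAlgebra 𝓘(ℝ, E) G) :
    diffCoeff E π v ℓ (c ⊗ₜ X) = c * dirDeriv (fun g : G => ℓ (π g v)) 1 X := by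
  unfold diffCoeff
  erw [LinearMap.liftBaseChange_tmul]
  rfl

theorem IsSmoothRep.mdifferentiableAt {π : Representation ℂ G V} (hπ : IsSmoothRep E π) (v : V)
    (ℓ : Module.Dual ℂ V) (g : G) :
    MDifferentiableAt 𝓘(ℝ, E) 𝓘(ℝ, ℂ) (fun g : G => ℓ (π g v)) g :=
  ((hπ v ℓ).mdifferentiable (by simp)) g

theorem diffCoeff_map (π : Representation ℂ G V) (σ : Representation ℂ G U) (f : V →ₗ[ℂ] U)
    (hf : ∀ g v, f (π g v) = σ g (f v)) (v : V) (ℓ : Module.Dual ℂ U) :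
    diffCoeff E σ (f v) ℓ = diffCoeff E π v (ℓ ∘ₗ f) := by
  have h : (fun g : G => ℓ (σ g (f v))) = fun g => (ℓ ∘ₗ f) (π g v) :=
    funext fun g => congrArg ℓ (hf g v).symm
  unfold diffCoeff
  rw [h]

theorem DerivedActionEq.map {π : Representation ℂ G V} {σ : Representation ℂ G U} (f : V →ₗ[ℂ] U)
    (hf : ∀ g v, f (π g v) = σ g (f v)) {X : ComplexLieAlgebra E G} {v w : V}
    (h : DerivedActionEq E π X v w) : DerivedActionEq E σ X (f v) (f w) := by
  intro ℓ
  rw [diffCoeff_map π σ f hf, h]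
  rfl

/-- Every functional on `V` extends along `f` through a linear left inverse, which need not be
equivariant. -/
theorem DerivedActionEq.of_map {π : Representation ℂ G V} {σ : Representation ℂ G U}
    (f : V →ₗ[ℂ] U) (hf : ∀ g v, f (π g v) = σ g (f v)) (hinj : Function.Injective f)
    {X : ComplexLieAlgebra E G} {v w : V}
    (h : DerivedActionEq E σ X (f v) (f w)) : DerivedActionEq E π X v w := by
  intro ℓ
  obtain ⟨r, hr⟩ := LinearMap.exists_leftInverse_of_injective f (LinearMap.ker_eq_bot.2 hinj)
  have := h (ℓ ∘ₗ r)
  rw [diffCoeff_map π σ f hf, LinearMap.comp_assoc, hr, LinearMap.comp_id] at this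
  rw [this]
  simp [← LinearMap.comp_apply, hr]

theorem diffCoeff_functional_add {π : Representation ℂ G V} (hπ : IsSmoothRep E π) (v : V)
    (ℓ ℓ' : Module.Dual ℂ V) (X : ComplexLieAlgebra E G) :
    diffCoeff E π v (ℓ + ℓ') X = diffCoeff E π v ℓ X + diffCoeff E π v ℓ' X := by
  induction X using TensorProduct.induction_on with
  | zero => simp
  | tmul c X =>
    simp only [diffCoeff_tmul, LinearMap.add_apply,
      dirDeriv_add (hπ.mdifferentiableAt v ℓ 1) (hπ.mdifferentiableAt v ℓ' 1), mul_add]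
  | add X Y hX hY => simp only [map_add, hX, hY]; ring

theorem diffCoeff_functional_smul {π : Representation ℂ G V} (hπ : IsSmoothRep E π) (v : V)
    (c : ℂ) (ℓ : Module.Dual ℂ V) (X : ComplexLieAlgebra E G) :
    diffCoeff E π v (c • ℓ) X = c * diffCoeff E π v ℓ X := by
  induction X using TensorProduct.induction_on with
  | zero => simp
  | tmul d X =>
    simp only [diffCoeff_tmul, LinearMap.smul_apply, smul_eq_mul,
      dirDeriv_const_mul (hπ.mdifferentiableAt v ℓ 1)]
    ring
  | add X Y hX hY => simp only [map_add, hX, hY]; ring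

theorem diffCoeff_vector_add {π : Representation ℂ G V} (hπ : IsSmoothRep E π) (v w : V)
    (ℓ : Module.Dual ℂ V) (X : ComplexLieAlgebra E G) :
    diffCoeff E π (v + w) ℓ X = diffCoeff E π v ℓ X + diffCoeff E π w ℓ X := by
  induction X using TensorProduct.induction_on with
  | zero => simp
  | tmul c X =>
    simp only [diffCoeff_tmul, map_add,
      dirDeriv_add (hπ.mdifferentiableAt v ℓ 1) (hπ.mdifferentiableAt w ℓ 1), mul_add]
  | add X Y hX hY => simp only [map_add, hX, hY]; ring

theorem diffCoeff_vector_smul {π : Representation ℂ G V} (hπ : IsSmoothRep E π) (v : V)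
    (c : ℂ) (ℓ : Module.Dual ℂ V) (X : ComplexLieAlgebra E G) :
    diffCoeff E π (c • v) ℓ X = c * diffCoeff E π v ℓ X := by
  induction X using TensorProduct.induction_on with
  | zero => simp
  | tmul d X =>
    simp only [diffCoeff_tmul, map_smul, smul_eq_mul,
      dirDeriv_const_mul (hπ.mdifferentiableAt v ℓ 1)]
    ring
  | add X Y hX hY => simp only [map_add, hX, hY]; ring

variable [FiniteDimensional ℂ U] {π : Representation ℂ G U}

/-- The vector `dπ(X) v`, for a smooth finite dimensional representation `π`. -/
def derivedVec (hπ : IsSmoothRep E π) (X : ComplexLieAlgebra E G) (v : U) : U :=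
  (Module.evalEquiv ℂ U).symm
    { toFun := fun ℓ => diffCoeff E π v ℓ X
      map_add' := fun ℓ ℓ' => diffCoeff_functional_add hπ v ℓ ℓ' X
      map_smul' := fun c ℓ => diffCoeff_functional_smul hπ v c ℓ X }

theorem apply_derivedVec (hπ : IsSmoothRep E π) (X : ComplexLieAlgebra E G) (v : U)
    (ℓ : Module.Dual ℂ U) : ℓ (derivedVec hπ X v) = diffCoeff E π v ℓ X := by
  simp [derivedVec]

theorem eq_of_forall_dual {v w : U} (h : ∀ ℓ : Module.Dual ℂ U, ℓ v = ℓ w) : v = w :=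
  (Module.evalEquiv ℂ U).injective (LinearMap.ext h)

theorem derivedActionEq_iff (hπ : IsSmoothRep E π) {X : ComplexLieAlgebra E G} {v w : U} :
    DerivedActionEq E π X v w ↔ derivedVec hπ X v = w := by
  refine ⟨fun h => eq_of_forall_dual fun ℓ => ?_, ?_⟩
  · rw [apply_derivedVec, h]
  · rintro rfl ℓ
    rw [apply_derivedVec]

theorem apply_derivedVec_tmul (hπ : IsSmoothRep E π) (X : GroupLieAlgebra 𝓘(ℝ, E) G) (v : U)
    (ℓ : Module.Dual ℂ U) :
    ℓ (derivedVec hπ ((1 : ℂ) ⊗ₜ[ℝ] X) v) = dirDeriv (fun g : G => ℓ (π g v)) 1 X := by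
  rw [apply_derivedVec, diffCoeff_tmul, one_mul]

theorem derivedVec_add (hπ : IsSmoothRep E π) (X Y : ComplexLieAlgebra E G) (v : U) :
    derivedVec hπ (X + Y) v = derivedVec hπ X v + derivedVec hπ Y v :=
  eq_of_forall_dual fun ℓ => by simp only [map_add, apply_derivedVec]

theorem derivedVec_smul (hπ : IsSmoothRep E π) (c : ℂ) (X : ComplexLieAlgebra E G) (v : U) :
    derivedVec hπ (c • X) v = c • derivedVec hπ X v :=
  eq_of_forall_dual fun ℓ => by simp only [map_smul, apply_derivedVec]

theorem derivedVec_vector_add (hπ : IsSmoothRep E π) (X : ComplexLieAlgebra E G) (v w : U) :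
    derivedVec hπ X (v + w) = derivedVec hπ X v + derivedVec hπ X w :=
  eq_of_forall_dual fun ℓ => by simp only [map_add, apply_derivedVec, diffCoeff_vector_add hπ]

theorem derivedVec_vector_smul (hπ : IsSmoothRep E π) (c : ℂ) (X : ComplexLieAlgebra E G)
    (v : U) : derivedVec hπ X (c • v) = c • derivedVec hπ X v :=
  eq_of_forall_dual fun ℓ => by
    simp only [map_smul, apply_derivedVec, diffCoeff_vector_smul hπ, smul_eq_mul]

theorem mulInvariantVectorField_one (Z : GroupLieAlgebra 𝓘(ℝ, E) G) :
    mulInvariantVectorField Z 1 = Z := by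
  have h : ((1 : G) * ·) = id := funext one_mul
  unfold mulInvariantVectorField
  rw [h, mfderiv_id]
  rfl

variable [LieGroup 𝓘(ℝ, E) ∞ G]

theorem dirDeriv_comp_mul_left {f : G → ℂ} (hf : ContMDiff 𝓘(ℝ, E) 𝓘(ℝ, ℂ) ∞ f) (g : G)
    (X : GroupLieAlgebra 𝓘(ℝ, E) G) :
    dirDeriv (fun h => f (g * h)) 1 X = dirDeriv f g (mulInvariantVectorField X g) := by
  have hL : MDifferentiableAt 𝓘(ℝ, E) 𝓘(ℝ, E) (g * ·) (1 : G) :=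
    (contMDiff_mul_left (I := 𝓘(ℝ, E)) (n := ∞)).mdifferentiable (by simp) 1
  have h := mfderiv_comp (I' := 𝓘(ℝ, E)) (1 : G) ((hf.mdifferentiable (by simp)) (g * 1)) hL
  refine (DFunLike.congr_fun h X).trans ?_
  -- The chain rule ends at `g * 1`; all tangent spaces are copies of `E`, so the base point can be
  -- replaced by `g`.
  have aux : ∀ (k : G), k = g → ∀ Y : E,
      dirDeriv f k (Y : TangentSpace 𝓘(ℝ, E) k) = dirDeriv f g (Y : TangentSpace 𝓘(ℝ, E) g) := by
    rintro k rfl Y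
    rfl
  exact aux (g * 1) (mul_one g) _

/-- Since `π (g * h) = π g ∘ π h`, a left-invariant derivative of a coefficient is again a
coefficient. It is therefore smooth and can be differentiated again. -/
theorem dirDeriv_coeff_mulInvariantVectorField (hπ : IsSmoothRep E π) (g : G)
    (X : GroupLieAlgebra 𝓘(ℝ, E) G) (v : U) (ℓ : Module.Dual ℂ U) :
    dirDeriv (fun h : G => ℓ (π h v)) g (mulInvariantVectorField X g) =
      ℓ (π g (derivedVec hπ ((1 : ℂ) ⊗ₜ[ℝ] X) v)) := by
  rw [← dirDeriv_comp_mul_left (hπ v ℓ), ← LinearMap.comp_apply, apply_derivedVec_tmul]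
  simp only [map_mul, Module.End.mul_apply, LinearMap.comp_apply]

variable [FiniteDimensional ℝ E]

/-- The commutator formula for the left-invariant fields of `X` and `Y`, applied to a coefficient
and evaluated at `1`. -/
theorem derivedVec_lie_one_tmul (hπ : IsSmoothRep E π) (X Y : GroupLieAlgebra 𝓘(ℝ, E) G)
    (v : U) :
    derivedVec hπ ((1 : ℂ) ⊗ₜ[ℝ] ⁅X, Y⁆) v =
      derivedVec hπ ((1 : ℂ) ⊗ₜ[ℝ] X) (derivedVec hπ ((1 : ℂ) ⊗ₜ[ℝ] Y) v) -
      derivedVec hπ ((1 : ℂ) ⊗ₜ[ℝ] Y) (derivedVec hπ ((1 : ℂ) ⊗ₜ[ℝ] X) v) := by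
  refine eq_of_forall_dual fun ℓ => ?_
  have : CompleteSpace E := FiniteDimensional.complete ℝ E
  rw [map_sub, apply_derivedVec_tmul, apply_derivedVec_tmul, apply_derivedVec_tmul,
    GroupLieAlgebra.bracket_def]
  have : IsManifold 𝓘(ℝ, E) ∞ G := ContMDiffMul.toIsManifold (I := 𝓘(ℝ, E)) (n := ∞) (G := G)
  have h := mfderiv_apply_mlieBracket (hπ v ℓ) (x := (1 : G))
    (mdifferentiableAt_mulInvariantVectorField X) (mdifferentiableAt_mulInvariantVectorField Y)
    (fun g => (dirDeriv_coeff_mulInvariantVectorField hπ g X v ℓ).symm)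
    (fun g => (dirDeriv_coeff_mulInvariantVectorField hπ g Y v ℓ).symm)
    (hπ.mdifferentiableAt _ _ _) (hπ.mdifferentiableAt _ _ _)
  rw [mulInvariantVectorField_one, mulInvariantVectorField_one] at h
  exact h

/-- Complex bilinearity extends the bracket relation from real elements; the form is the one
required by `leibniz_lie`. -/
theorem derivedVec_lie (hπ : IsSmoothRep E π) (X Y : ComplexLieAlgebra E G) (v : U) :
    derivedVec hπ X (derivedVec hπ Y v) =
      derivedVec hπ ⁅X, Y⁆ v + derivedVec hπ Y (derivedVec hπ X v) := by
  have h0 : ∀ v : U, derivedVec hπ (0 : ComplexLieAlgebra E G) v = 0 := fun v => by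
    simpa using derivedVec_smul hπ 0 (0 : ComplexLieAlgebra E G) v
  have h0' : ∀ X : ComplexLieAlgebra E G, derivedVec hπ X (0 : U) = 0 := fun X => by
    simpa using derivedVec_vector_smul hπ 0 X (0 : U)
  induction X using TensorProduct.induction_on with
  | zero => simp only [zero_lie, h0, h0', add_zero]
  | add X X' hX hX' =>
    simp only [add_lie, derivedVec_add, derivedVec_vector_add, hX, hX']
    abel
  | tmul c X =>
    induction Y using TensorProduct.induction_on with
    | zero =>
      have h : ⁅(c ⊗ₜ[ℝ] X : ComplexLieAlgebra E G), (0 : ComplexLieAlgebra E G)⁆ = 0 :=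
        lie_zero (L := ComplexLieAlgebra E G) (M := ComplexLieAlgebra E G) _
      rw [h]
      simp only [h0, h0', add_zero]
    | add Y Y' hY hY' =>
      have h : ⁅(c ⊗ₜ[ℝ] X : ComplexLieAlgebra E G), (Y + Y' : ComplexLieAlgebra E G)⁆ =
          ⁅(c ⊗ₜ[ℝ] X : ComplexLieAlgebra E G), (Y : ComplexLieAlgebra E G)⁆ +
          ⁅(c ⊗ₜ[ℝ] X : ComplexLieAlgebra E G), (Y' : ComplexLieAlgebra E G)⁆ :=
        lie_add (L := ComplexLieAlgebra E G) (M := ComplexLieAlgebra E G) _ _ _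
      rw [h]
      simp only [derivedVec_add, derivedVec_vector_add, hY, hY']
      abel
    | tmul d Y =>
      have key : ∀ (a : ℂ) (Z : GroupLieAlgebra 𝓘(ℝ, E) G),
          a ⊗ₜ[ℝ] Z = a • ((1 : ℂ) ⊗ₜ[ℝ] Z) := fun a Z => by
        rw [TensorProduct.smul_tmul', smul_eq_mul, mul_one]
      rw [LieAlgebra.ExtendScalars.bracket_tmul, key c X, key d Y, key (c * d)]
      simp only [derivedVec_smul, derivedVec_vector_smul, derivedVec_lie_one_tmul]
      module

/-- The derived representation of the complexified Lie algebra. -/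
abbrev derivedLieRingModule (hπ : IsSmoothRep E π) : LieRingModule (ComplexLieAlgebra E G) U where
  bracket X v := derivedVec hπ X v
  add_lie := derivedVec_add hπ
  lie_add := derivedVec_vector_add hπ
  leibniz_lie := derivedVec_lie hπ

theorem derivedLieModule (hπ : IsSmoothRep E π) :
    letI := derivedLieRingModule hπ
    LieModule ℂ (ComplexLieAlgebra E G) U :=
  letI := derivedLieRingModule hπ
  { smul_lie := derivedVec_smul hπ
    lie_smul := fun c X v => derivedVec_vector_smul hπ c X v }

end DerivedRep

/-! ### From stability under the Lie algebra to stability under the connected group -/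

/-- Uniqueness of the zero solution of a linear system of ordinary differential equations. -/
theorem eq_zero_of_linear_ode {ι : Type*} [Fintype ι] {F D : ι → ℝ → ℂ} {C : ι → ι → ℝ → ℂ}
    (hF : ∀ k, ∀ t ∈ Set.Icc (0 : ℝ) 1, HasDerivAt (F k) (D k t) t)
    (hD : ∀ k, ∀ t ∈ Set.Icc (0 : ℝ) 1, D k t = ∑ l, C l k t * F l t)
    (hC : ∀ l k, ContinuousOn (C l k) (Set.Icc 0 1)) (h0 : ∀ k, F k 0 = 0) (k : ι) {t : ℝ}
    (ht : t ∈ Set.Icc (0 : ℝ) 1) : F k t = 0 := by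
  have hb : ∀ l k, ∃ B, ∀ t ∈ Set.Icc (0 : ℝ) 1, ‖C l k t‖ ≤ B := fun l k =>
    isCompact_Icc.exists_bound_of_continuousOn (hC l k)
  choose B hB using hb
  have hB0 : ∀ l k, 0 ≤ B l k := fun l k =>
    (norm_nonneg _).trans (hB l k 0 (by simp))
  -- The sum of all entry bounds dominates each row sum, hence the operator norm for the sup norm.
  let K : ℝ := ∑ k, ∑ l, B l k
  let Φ : ℝ → ι → ℂ := fun s k => F k s
  have key := norm_le_gronwallBound_of_norm_deriv_right_le (f := Φ) (f' := fun s k => D k s)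
    (δ := 0) (K := K) (ε := 0) (a := 0) (b := 1)
    (continuousOn_pi.2 fun k s hs => (hF k s hs).continuousAt.continuousWithinAt)
    (fun s hs => hasDerivWithinAt_pi.2 fun k =>
      (hF k s (Set.Ico_subset_Icc_self hs)).hasDerivWithinAt)
    (by
      have : Φ 0 = 0 := funext h0
      simp [this])
    (fun s hs => by
      have hs' := Set.Ico_subset_Icc_self hs
      rw [add_zero, pi_norm_le_iff_of_nonneg
        (mul_nonneg (Finset.sum_nonneg fun k _ => Finset.sum_nonneg fun l _ => hB0 l k)
          (norm_nonneg _))]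
      intro k
      rw [hD k s hs']
      calc ‖∑ l, C l k s * F l s‖ ≤ ∑ l, B l k * ‖Φ s‖ := by
            refine norm_sum_le_of_le _ fun l _ => ?_
            rw [norm_mul]
            exact mul_le_mul (hB l k s hs') (norm_le_pi_norm (Φ s) l) (norm_nonneg _) (hB0 l k)
        _ = (∑ l, B l k) * ‖Φ s‖ := (Finset.sum_mul _ _ _).symm
        _ ≤ K * ‖Φ s‖ := by
            refine mul_le_mul_of_nonneg_right ?_ (norm_nonneg _)
            exact Finset.single_le_sum (f := fun k => ∑ l, B l k)
              (fun k _ => Finset.sum_nonneg fun l _ => hB0 l k) (Finset.mem_univ k))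
    t ht
  rw [gronwallBound_ε0_δ0] at key
  exact congrFun (norm_le_zero_iff.1 key) k

section Connected

variable {E : Type uE} [NormedAddCommGroup E] [NormedSpace ℝ E]
  {G : Type uG} [Group G] [TopologicalSpace G] [ChartedSpace E G] [LieGroup 𝓘(ℝ, E) ∞ G]

/-- Translation by `g` undoes translation by `g⁻¹`, so its differential at `1` is surjective. -/
theorem exists_mulInvariantVectorField_eq (g : G) (Z : TangentSpace 𝓘(ℝ, E) g) :
    ∃ X : GroupLieAlgebra 𝓘(ℝ, E) G, mulInvariantVectorField X g = Z := by
  have hd : ∀ a b : G, MDifferentiableAt 𝓘(ℝ, E) 𝓘(ℝ, E) (a * ·) b := fun a b =>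
    (contMDiff_mul_left (I := 𝓘(ℝ, E)) (n := ∞)).mdifferentiable (by simp) b
  have h := mfderiv_comp (I' := 𝓘(ℝ, E)) g (hd g (g⁻¹ * g)) (hd g⁻¹ g)
  have hid : ((g * ·) ∘ (g⁻¹ * ·) : G → G) = id := by ext; simp
  rw [hid, mfderiv_id] at h
  have aux : ∀ k : G, k = 1 → ∀ Y : E,
      (mfderiv 𝓘(ℝ, E) 𝓘(ℝ, E) (g * ·) k : E →L[ℝ] E) Y =
      (mfderiv 𝓘(ℝ, E) 𝓘(ℝ, E) (g * ·) (1 : G) : E →L[ℝ] E) Y := by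
    rintro k rfl Y
    rfl
  refine ⟨(mfderiv 𝓘(ℝ, E) 𝓘(ℝ, E) (g⁻¹ * ·) g Z : E), ?_⟩
  exact (aux _ (inv_mul_cancel g) _).symm.trans (DFunLike.congr_fun h Z).symm

variable {U : Type uW} [AddCommGroup U] [Module ℂ U] {π : Representation ℂ G U}

theorem IsSmoothRep.contDiffOn_chart (hπ : IsSmoothRep E π) (v : U) (ℓ : Module.Dual ℂ U) :
    ContDiffOn ℝ ∞ (fun y => ℓ (π ((extChartAt 𝓘(ℝ, E) (1 : G)).symm y) v))
      (extChartAt 𝓘(ℝ, E) (1 : G)).target := by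
  have : IsManifold 𝓘(ℝ, E) ∞ G := ContMDiffMul.toIsManifold (I := 𝓘(ℝ, E)) (n := ∞) (G := G)
  rw [← contMDiffOn_iff_contDiffOn]
  exact (hπ v ℓ).comp_contMDiffOn (contMDiffOn_extChartAt_symm (1 : G))

variable [FiniteDimensional ℂ U]

/-- `X` is the velocity `u` translated back to the identity. It depends only on `y` and `u`, so one
`X` serves all coefficients. -/
theorem exists_fderiv_coeff_chart_eq (hπ : IsSmoothRep E π) {y : E}
    (hy : y ∈ (extChartAt 𝓘(ℝ, E) (1 : G)).target) (u : E) :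
    ∃ X : GroupLieAlgebra 𝓘(ℝ, E) G, ∀ (v : U) (ℓ : Module.Dual ℂ U),
      fderiv ℝ (fun y => ℓ (π ((extChartAt 𝓘(ℝ, E) (1 : G)).symm y) v)) y u =
        ℓ (π ((extChartAt 𝓘(ℝ, E) (1 : G)).symm y) (derivedVec hπ ((1 : ℂ) ⊗ₜ[ℝ] X) v)) := by
  have : IsManifold 𝓘(ℝ, E) ∞ G := ContMDiffMul.toIsManifold (I := 𝓘(ℝ, E)) (n := ∞) (G := G)
  have : IsManifold 𝓘(ℝ, E) 1 G := .of_le (n := ∞) (by simp)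
  have hd := mdifferentiableWithinAt_extChartAt_symm (I := 𝓘(ℝ, E)) hy
  simp only [modelWithCornersSelf_coe, Set.range_id, mdifferentiableWithinAt_univ] at hd
  obtain ⟨X, hX⟩ := exists_mulInvariantVectorField_eq _
    (mfderiv 𝓘(ℝ, E) 𝓘(ℝ, E) (extChartAt 𝓘(ℝ, E) (1 : G)).symm y u)
  refine ⟨X, fun v ℓ => ?_⟩
  rw [← dirDeriv_coeff_mulInvariantVectorField, hX, ← mfderiv_eq_fderiv]
  exact DFunLike.congr_fun (mfderiv_comp (I' := 𝓘(ℝ, E)) y (hπ.mdifferentiableAt v ℓ _) hd) u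

/-- Let γ be a straight ray from `1` in a chart, `m` a basis of `M`, and ℓ a functional vanishing on
`M`. The derivative of ℓ(π(γ) m_k) is ℓ(π(γ) dπ(X_t) m_k), and dπ(X_t) m_k stays in `M`. So these
functions solve a homogeneous linear system with zero initial values and vanish. -/
theorem exists_nhds_one_apply_mem (hπ : IsSmoothRep E π) (M : Submodule ℂ U)
    (hM : ∀ X : GroupLieAlgebra 𝓘(ℝ, E) G, ∀ v ∈ M, derivedVec hπ ((1 : ℂ) ⊗ₜ[ℝ] X) v ∈ M) :
    ∀ᶠ g in nhds (1 : G), ∀ v ∈ M, π g v ∈ M := by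
  have : IsTopologicalGroup G := topologicalGroup_of_lieGroup 𝓘(ℝ, E) ∞
  set φ := extChartAt 𝓘(ℝ, E) (1 : G) with hφ
  have htarget : IsOpen φ.target := isOpen_extChartAt_target (1 : G)
  obtain ⟨r, hr, hball⟩ := Metric.mem_nhds_iff.1 (extChartAt_target_mem_nhds (I := 𝓘(ℝ, E)) (1 : G))
  suffices h : ∀ y ∈ Metric.ball (φ 1) r, ∀ v ∈ M, π (φ.symm y) v ∈ M by
    filter_upwards [extChartAt_source_mem_nhds (I := 𝓘(ℝ, E)) (1 : G),
      (continuousAt_extChartAt (I := 𝓘(ℝ, E)) (1 : G)) (Metric.ball_mem_nhds _ hr)] with g hg hg'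
    have := h (φ g) hg'
    rwa [φ.left_inv hg] at this
  intro y hy
  set u := y - φ 1 with hu
  have hc : ∀ t ∈ Set.Icc (0 : ℝ) 1, φ 1 + t • u ∈ φ.target := by
    intro t ht
    apply hball
    rw [mem_ball_iff_norm, add_sub_cancel_left, norm_smul, Real.norm_of_nonneg ht.1]
    rw [mem_ball_iff_norm] at hy
    exact (mul_le_of_le_one_left (norm_nonneg _) ht.2).trans_lt hy
  have hγ : ContinuousOn (fun t : ℝ => φ.symm (φ 1 + t • u)) (Set.Icc 0 1) :=
    (continuousOn_extChartAt_symm (1 : G)).comp (by fun_prop) hc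
  let m := Module.finBasis ℂ M
  let b := Module.finBasis ℂ U
  obtain ⟨ψ, hψ⟩ := LinearMap.exists_leftInverse_of_injective M.subtype M.ker_subtype
  have hψ' : ∀ w (hw : w ∈ M), ψ w = ⟨w, hw⟩ := fun w hw => DFunLike.congr_fun hψ ⟨w, hw⟩
  let H (v : U) (ℓ : Module.Dual ℂ U) (t : ℝ) : ℂ :=
    fderiv ℝ (fun y => ℓ (π (φ.symm y) v)) (φ 1 + t • u) u
  have hHderiv : ∀ v ℓ, ∀ t ∈ Set.Icc (0 : ℝ) 1,
      HasDerivAt (fun t : ℝ => ℓ (π (φ.symm (φ 1 + t • u)) v)) (H v ℓ t) t := by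
    intro v ℓ t ht
    have h1 := ((hπ.contDiffOn_chart v ℓ).differentiableOn (by simp) _ (hc t ht)).differentiableAt
      (htarget.mem_nhds (hc t ht))
    have h2 : HasDerivAt (fun t : ℝ => φ 1 + t • u) u t := by
      simpa using ((hasDerivAt_id t).smul_const u).const_add (φ 1)
    exact h1.hasFDerivAt.comp_hasDerivAt t h2
  have hHcont : ∀ v ℓ, ContinuousOn (H v ℓ) (Set.Icc 0 1) := by
    intro v ℓ
    have h1 := (hπ.contDiffOn_chart v ℓ).continuousOn_fderiv_of_isOpen htarget (by simp)
    have h2 : ContinuousOn (fun t : ℝ => φ 1 + t • u) (Set.Icc 0 1) := by fun_prop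
    exact (h1.comp h2 hc).clm_apply continuousOn_const
  -- The coordinate of dπ(X_t) m_k along m_l, written as π(γ)⁻¹ applied to the derivative of π(γ)
  -- m_k. This form is visibly continuous in `t`, whereas X_t is only known to exist pointwise.
  let C (l k : Fin (Module.finrank ℂ M)) (t : ℝ) : ℂ :=
    ∑ i, m.coord l (ψ (π (φ.symm (φ 1 + t • u))⁻¹ (b i))) * H (m k) (b.coord i) t
  have hC : ∀ l k, ContinuousOn (C l k) (Set.Icc 0 1) := by
    intro l k
    refine continuousOn_finsetSum _ fun i _ => ContinuousOn.mul ?_ (hHcont _ _)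
    exact (hπ (b i) (m.coord l ∘ₗ ψ)).continuous.comp_continuousOn (hγ.inv)
  have hmem : ∀ k, π (φ.symm y) (m k : U) ∈ M := by
    intro k
    by_contra hk
    obtain ⟨ℓ, hℓ, hℓM⟩ := Submodule.exists_le_ker_of_notMem hk
    refine hℓ ?_
    have hval : ∀ w ∈ M, ℓ w = 0 := fun w hw => hℓM hw
    have := eq_zero_of_linear_ode (C := C)
      (F := fun k t => ℓ (π (φ.symm (φ 1 + t • u)) (m k)))
      (D := fun k t => H (m k) ℓ t)
      (fun k t ht => hHderiv _ _ t ht) ?_ hC (fun k => by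
        simp only [zero_smul, add_zero, hφ, extChartAt_to_inv, map_one]
        exact hval _ (m k).2) k (t := 1) (by simp)
    · simpa [hu] using this
    · intro k t ht
      obtain ⟨X, hX⟩ := exists_fderiv_coeff_chart_eq hπ (hc t ht) u
      set w := derivedVec hπ ((1 : ℂ) ⊗ₜ[ℝ] X) (m k : U) with hw
      have hwM : w ∈ M := hM X _ (m k).2
      have hCk : ∀ l, C l k t = m.coord l ⟨w, hwM⟩ := by
        intro l
        have h1 : ∀ i, H (m k) (b.coord i) t = b.coord i (π (φ.symm (φ 1 + t • u)) w) :=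
          fun i => hX _ _
        simp only [C, h1]
        have h2 := b.sum_repr (π (φ.symm (φ 1 + t • u)) w)
        have h3 : π (φ.symm (φ 1 + t • u))⁻¹ (π (φ.symm (φ 1 + t • u)) w) = w := by
          rw [← Module.End.mul_apply, ← map_mul, inv_mul_cancel, map_one, Module.End.one_apply]
        have h4 := congrArg
          (fun z => m.coord l (ψ (π (φ.symm (φ 1 + t • u))⁻¹ z))) h2
        simp only [map_sum, map_smul, smul_eq_mul, h3, hψ' w hwM] at h4
        rw [← h4]
        exact Finset.sum_congr rfl fun i _ => mul_comm _ _
      simp only [hCk]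
      have h4 := congrArg (fun z : M => ℓ (π (φ.symm (φ 1 + t • u)) (z : U)))
        (m.sum_repr ⟨w, hwM⟩)
      simp only [Submodule.coe_sum, Submodule.coe_smul, map_sum, map_smul, smul_eq_mul] at h4
      exact (hX _ _).trans h4.symm
  intro v hv
  have h5 := congrArg (fun z : M => π (φ.symm y) (z : U)) (m.sum_repr ⟨v, hv⟩)
  simp only [Submodule.coe_sum, Submodule.coe_smul, map_sum, map_smul] at h5
  rw [← h5]
  exact M.sum_mem fun k _ => M.smul_mem _ (hmem k)

/-- In a smooth finite dimensional representation of a connected Lie group, a subspace stable under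
the derived action is stable under the group. -/
theorem apply_mem_of_derivedVec_mem [ConnectedSpace G] (hπ : IsSmoothRep E π) (M : Submodule ℂ U)
    (hM : ∀ X : GroupLieAlgebra 𝓘(ℝ, E) G, ∀ v ∈ M, derivedVec hπ ((1 : ℂ) ⊗ₜ[ℝ] X) v ∈ M)
    (g : G) {v : U} (hv : v ∈ M) : π g v ∈ M := by
  have : IsTopologicalGroup G := topologicalGroup_of_lieGroup 𝓘(ℝ, E) ∞
  have hN := exists_nhds_one_apply_mem hπ M hM
  have hN' : ∀ᶠ g in nhds (1 : G), ∀ v ∈ M, π g⁻¹ v ∈ M := by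
    have h : Filter.Tendsto (fun g : G => g⁻¹) (nhds 1) (nhds 1) := by
      simpa using (continuous_inv (G := G)).tendsto 1
    exact h.eventually hN
  -- An open subgroup of a connected group is everything; asking the same of `g⁻¹` makes closure
  -- under inverses automatic.
  let S : Subgroup G :=
    { carrier := {g | (∀ v ∈ M, π g v ∈ M) ∧ ∀ v ∈ M, π g⁻¹ v ∈ M}
      one_mem' := by simp
      mul_mem' := fun {a b} ha hb => ⟨fun v hv => by
          rw [map_mul]; exact ha.1 _ (hb.1 v hv), fun v hv => by
          rw [mul_inv_rev, map_mul]; exact hb.2 _ (ha.2 v hv)⟩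
      inv_mem' := fun {a} ha => ⟨ha.2, by simpa using ha.1⟩ }
  have hSo : IsOpen (S : Set G) := S.isOpen_of_mem_nhds (g := 1) (hN.and hN')
  have hS : (S : Set G) = Set.univ :=
    IsClopen.eq_univ ⟨S.isClosed_of_isOpen hSo, hSo⟩ ⟨1, S.one_mem⟩
  exact ((Set.eq_univ_iff_forall.1 hS) g).1 v hv

end Connected

/-! ### Weights in the module generated by a highest weight vector -/

section HighestWeightModule

/-- A real functional is the real part of a complex one, which by reflexivity is evaluation at a
vector. The order on roots thereby becomes an order on real parts of eigenvalues of one element. -/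
theorem exists_forall_eq_re_apply {H : Type*} [AddCommGroup H] [Module ℂ H]
    [FiniteDimensional ℂ H] (f : Module.Dual ℂ H →ₗ[ℝ] ℝ) :
    ∃ h : H, ∀ α : Module.Dual ℂ H, f α = (α h).re := by
  refine ⟨(Module.evalEquiv ℂ H).symm (Module.Dual.extendRCLike (𝕜 := ℂ) f), fun α => ?_⟩
  rw [Module.apply_evalEquiv_symm_apply, Module.Dual.extendRCLike_apply]
  simp

variable {L : Type*} [LieRing L] [LieAlgebra ℂ L]
  {H : LieSubalgebra ℂ L} [H.IsCartanSubalgebra]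
  {M : Type*} [AddCommGroup M] [Module ℂ M] [LieRingModule L M] [LieModule ℂ L M]

/-- In the Lie submodule generated by a highest weight vector `w`, every vector of the same weight
is a multiple of `w`. -/
theorem mem_span_singleton_of_mem_lieSpan_highestWeightVector [FiniteDimensional ℂ L]
    {order : Module.Dual ℂ H →ₗ[ℝ] ℝ}
    (regular : ∀ α : Module.Dual ℂ H, α ≠ 0 →
      LieAlgebra.rootSpace H (α : H → ℂ) ≠ ⊥ → order α ≠ 0)
    {w : M} (hpos : ∀ α : Module.Dual ℂ H, 0 < order α →
      ∀ X ∈ LieAlgebra.rootSpace H (α : H → ℂ), ⁅X, w⁆ = 0)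
    {wt : Module.Dual ℂ H} (hwt : ∀ h : H, ⁅(h : L), w⁆ = wt h • w)
    {u : M} (hu : u ∈ LieSubmodule.lieSpan ℂ L {w}) (huwt : ∀ h : H, ⁅(h : L), u⁆ = wt h • u) :
    u ∈ Submodule.span ℂ {w} := by
  -- The smallest good subspace `N` plays the role of U(𝔫⁻)w, and its minimality that of the
  -- Poincaré–Birkhoff–Witt theorem.
  let good (N : Submodule ℂ M) : Prop := w ∈ N ∧ ∀ α : Module.Dual ℂ H, order α < 0 →
    ∀ Y ∈ LieAlgebra.rootSpace H (α : H → ℂ), ∀ m ∈ N, ⁅Y, m⁆ ∈ N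
  let N : Submodule ℂ M := sInf {N | good N}
  have hN : good N := ⟨Submodule.mem_sInf.2 fun K hK => hK.1, fun α hα Y hY m hm =>
    Submodule.mem_sInf.2 fun K hK => hK.2 α hα Y hY m (Submodule.mem_sInf.1 hm K hK)⟩
  have hle : ∀ K, good K → N ≤ K := fun K hK => sInf_le hK
  -- Split `X` into root components: the zero root space is `H` and acts by a scalar, positive roots
  -- kill `w`, negative ones preserve `N`. By regularity there are no other roots.
  have hLw : ∀ X : L, ⁅X, w⁆ ∈ N := by
    intro X
    have hX : X ∈ ⨆ χ : LieModule.Weight ℂ H L, LieModule.genWeightSpace L χ := by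
      rw [LieModule.iSup_genWeightSpace_eq_top' ℂ H L]
      trivial
    induction hX using LieSubmodule.iSup_induction' with
    | zero => simp
    | add x y _ _ hx hy =>
      rw [add_lie]
      exact N.add_mem hx hy
    | mem χ x hx =>
      rcases eq_or_ne (χ.toLinear ℂ H L) 0 with h0 | h0
      · have h0' : (χ : H → ℂ) = 0 := funext fun y => LinearMap.congr_fun h0 y
        rw [h0'] at hx
        have hxH : x ∈ H := by
          have := LieAlgebra.rootSpace_zero_eq ℂ L H
          rw [← LieSubalgebra.mem_toLieSubmodule, ← this]
          exact hx
        rw [hwt ⟨x, hxH⟩]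
        exact N.smul_mem _ hN.1
      · rcases lt_or_gt_of_ne (regular _ h0 χ.genWeightSpace_ne_bot) with h | h
        · exact hN.2 _ h x hx w hN.1
        · rw [hpos _ h x hx]
          exact N.zero_mem
  have hLN : ∀ m ∈ N, ∀ X : L, ⁅X, m⁆ ∈ N := by
    -- This subspace is good since XYm = [X,Y]m + YXm, so by minimality it is all of `N`.
    let K : Submodule ℂ M :=
      { carrier := {m | m ∈ N ∧ ∀ X : L, ⁅X, m⁆ ∈ N}
        add_mem' := fun {a b} ha hb => ⟨N.add_mem ha.1 hb.1, fun X => by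
          rw [lie_add]; exact N.add_mem (ha.2 X) (hb.2 X)⟩
        zero_mem' := ⟨N.zero_mem, fun X => by rw [lie_zero]; exact N.zero_mem⟩
        smul_mem' := fun c a ha => ⟨N.smul_mem c ha.1, fun X => by
          rw [lie_smul]; exact N.smul_mem c (ha.2 X)⟩ }
    have hK : good K := ⟨⟨hN.1, hLw⟩, fun α hα Y hY m hm =>
      ⟨hN.2 α hα Y hY m hm.1, fun X => by
        rw [leibniz_lie]
        exact N.add_mem (hm.2 _) (hN.2 α hα Y hY _ (hm.2 X))⟩⟩
    exact fun m hm => (hle K hK hm).2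
  have huN : u ∈ N := by
    let N' : LieSubmodule ℂ L M := { N with lie_mem := fun {X m} hm => hLN m hm X }
    have : LieSubmodule.lieSpan ℂ L {w} ≤ N' :=
      LieSubmodule.lieSpan_le.2 (Set.singleton_subset_iff.2 hN.1)
    exact this hu
  obtain ⟨h₀, hh₀⟩ := exists_forall_eq_re_apply order
  -- Generalized eigenspaces, because the root spaces of a general Cartan subalgebra are only
  -- generalized weight spaces.
  let e (μ : ℂ) : Submodule ℂ M := (LieModule.toEnd ℂ L M (h₀ : L)).maxGenEigenspace μ
  have he : ∀ m : M, (∀ h : H, ⁅(h : L), m⁆ = wt h • m) → m ∈ e (wt h₀) := by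
    intro m hm
    refine (Module.End.genEigenspace _ _).mono le_top
      (Module.End.mem_genEigenspace_one.2 (hm h₀))
  let lower : Submodule ℂ M := ⨆ μ : {μ : ℂ // μ.re < (wt h₀).re}, e μ
  have hlie : ∀ α : Module.Dual ℂ H, ∀ Y ∈ LieAlgebra.rootSpace H (α : H → ℂ), ∀ μ : ℂ,
      ∀ m ∈ e μ, ⁅Y, m⁆ ∈ e (α h₀ + μ) := by
    intro α Y hY μ m hm
    refine LieModule.lie_mem_maxGenEigenspace_toEnd ?_ hm
    have := (LieModule.mem_genWeightSpace L (α : H → ℂ) Y).1 hY h₀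
    obtain ⟨k, hk⟩ := this
    exact (Module.End.mem_maxGenEigenspace _ _ _).2 ⟨k, hk⟩
  -- A negative root vector strictly lowers the real part of the eigenvalue of `h₀`.
  have hgood : good (Submodule.span ℂ {w} ⊔ lower) := by
    refine ⟨Submodule.mem_sup_left (Submodule.mem_span_singleton_self w), ?_⟩
    intro α hα Y hY m hm
    rw [hh₀] at hα
    refine Submodule.mem_sup_right ?_
    obtain ⟨a, ha, s, hs, rfl⟩ := Submodule.mem_sup.1 hm
    have hmem : ∀ μ : ℂ, μ.re ≤ (wt h₀).re → ∀ m ∈ e μ, ⁅Y, m⁆ ∈ lower := fun μ hμ m hm =>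
      Submodule.mem_iSup_of_mem (p := fun μ : {μ : ℂ // μ.re < (wt h₀).re} => e μ)
        ⟨α h₀ + μ, by rw [Complex.add_re]; linarith⟩ (hlie α Y hY μ m hm)
    rw [lie_add]
    refine lower.add_mem ?_ ?_
    · obtain ⟨c, rfl⟩ := Submodule.mem_span_singleton.1 ha
      exact hmem _ le_rfl _ ((e _).smul_mem c (he w hwt))
    · refine Submodule.iSup_induction _ (motive := fun s => ⁅Y, s⁆ ∈ lower) hs ?_ ?_ ?_
      · exact fun μ m hm => hmem μ μ.2.le m hm
      · rw [lie_zero]; exact lower.zero_mem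
      · intro x y hx hy
        rw [lie_add]; exact lower.add_mem hx hy
  obtain ⟨a, ha, s, hs, rfl⟩ := Submodule.mem_sup.1 (hle _ hgood huN)
  -- `s` has the eigenvalue of `w` but lies in a sum of generalized eigenspaces for other
  -- eigenvalues, so independence forces `s = 0`.
  have hse : s ∈ e (wt h₀) := by
    have h1 := he _ huwt
    have h2 : a ∈ e (wt h₀) := (Submodule.span_singleton_le_iff_mem _ _).2 (he w hwt) ha
    simpa using (e (wt h₀)).sub_mem h1 h2
  have hdisj := (LieModule.toEnd ℂ L M (h₀ : L)).independent_maxGenEigenspace (wt h₀)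
  have hlow : lower ≤ ⨆ μ, ⨆ (_ : μ ≠ wt h₀), e μ :=
    iSup_le fun μ => le_iSup₂_of_le (μ : ℂ) (fun h => by
      have := μ.2
      rw [h] at this
      exact lt_irrefl _ this) le_rfl
  have hs0 : s = 0 := (Submodule.disjoint_def.1 hdisj) s hse (hlow hs)
  rw [hs0, add_zero]
  exact ha

end HighestWeightModule

/-! ### Subrepresentations of multiplicity free sums -/

section Subrep

variable {k : Type*} {G : Type uG} [Field k] [Group G] {V : Type uV} [AddCommGroup V] [Module k V]
  {π : Representation k G V}

namespace Subrepresentation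

/-- The subrepresentations of a subrepresentation `S` are the subrepresentations contained
in `S`. -/
def toRepresentationOrderIso (S : Subrepresentation π) :
    Subrepresentation S.toRepresentation ≃o Set.Iic S where
  toFun T := ⟨⟨T.toSubmodule.map S.toSubmodule.subtype, by
    rintro g _ ⟨w, hw, rfl⟩
    exact ⟨S.toRepresentation g w, T.apply_mem_toSubmodule g hw, rfl⟩⟩, by
    rintro _ ⟨w, _, rfl⟩
    exact w.2⟩
  invFun T := ⟨T.1.toSubmodule.comap S.toSubmodule.subtype, fun g v hv =>
    T.1.apply_mem_toSubmodule g hv⟩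
  left_inv T := by
    apply toSubmodule_injective
    exact Submodule.comap_map_eq_of_injective S.toSubmodule.injective_subtype _
  right_inv T := by
    apply Subtype.ext
    apply toSubmodule_injective
    refine (Submodule.map_comap_subtype _ _).trans (inf_eq_right.2 T.2)
  map_rel_iff' := by
    intro T T'
    exact Submodule.map_le_map_iff_of_injective S.toSubmodule.injective_subtype _ _

theorem isIrreducible_toRepresentation_iff (S : Subrepresentation π) :
    S.toRepresentation.IsIrreducible ↔ IsAtom S :=
  S.toRepresentationOrderIso.isSimpleOrder_iff.trans Set.isSimpleOrder_Iic_iff_isAtom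

theorem isSimpleModule_asSubmodule_iff (S : Subrepresentation π) :
    IsSimpleModule (MonoidAlgebra k G) S.asSubmodule ↔ S.toRepresentation.IsIrreducible := by
  rw [isIrreducible_toRepresentation_iff, isSimpleModule_iff_isAtom]
  exact (subrepresentationSubmoduleOrderIso (ρ := π)).isAtom_iff S

end Subrepresentation

/-- The projections onto the summands of a direct sum of subrepresentations. -/
theorem exists_equivariant_projections {ι : Type*} [DecidableEq ι] {W : ι → Subrepresentation π}
    (hW : DirectSum.IsInternal fun i => (W i).toSubmodule) :
    ∃ p : ι → V →ₗ[k] V, (∀ i v, p i v ∈ (W i).toSubmodule) ∧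
      (∀ i, ∀ v ∈ (W i).toSubmodule, p i v = v) ∧
      (∀ i j, i ≠ j → ∀ v ∈ (W j).toSubmodule, p i v = 0) ∧
      (∀ v, (∀ i, p i v = 0) → v = 0) ∧ ∀ i g v, p i (π g v) = π g (p i v) := by
  let e := LinearEquiv.ofBijective (DirectSum.coeLinearMap fun i => (W i).toSubmodule) hW
  have he : ∀ i (w : (W i).toSubmodule), e.symm w = DirectSum.lof k ι _ i w := fun i w => by
    rw [LinearEquiv.symm_apply_eq]
    exact (DirectSum.coeLinearMap_lof (fun i => (W i).toSubmodule) i w).symm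
  let p (i : ι) : V →ₗ[k] V :=
    (W i).toSubmodule.subtype ∘ₗ DirectSum.component k ι _ i ∘ₗ e.symm.toLinearMap
  have h1 : ∀ i, ∀ v ∈ (W i).toSubmodule, p i v = v := fun i v hv => by
    simp [p, he i ⟨v, hv⟩, DirectSum.component.lof_self]
  have h2 : ∀ i j, i ≠ j → ∀ v ∈ (W j).toSubmodule, p i v = 0 := fun i j hij v hv => by
    simp [p, he j ⟨v, hv⟩, DirectSum.component.of, hij.symm]
  refine ⟨p, fun i v => Subtype.coe_prop _, h1, h2, fun v hv => ?_, fun i g v => ?_⟩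
  · rw [← e.symm.map_eq_zero_iff]
    refine DFinsupp.ext fun i => ?_
    exact Subtype.ext (hv i)
  · have hv : v ∈ ⨆ i, (W i).toSubmodule := by
      rw [hW.submodule_iSup_eq_top]
      trivial
    refine Submodule.iSup_induction _ (motive := fun v => p i (π g v) = π g (p i v)) hv ?_ ?_ ?_
    · intro j w hw
      have hgw := (W j).apply_mem_toSubmodule g hw
      rcases eq_or_ne i j with rfl | hij
      · rw [h1 _ _ hw, h1 _ _ hgw]
      · rw [h2 _ _ hij _ hw, h2 _ _ hij _ hgw, map_zero]
    · simp
    · intro x y hx hy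
      simp only [map_add, hx, hy]

/-- A subrepresentation of a multiplicity free direct sum of irreducible representations contains
the components of its elements. -/
theorem component_mem_of_mem {ι : Type*} [DecidableEq ι] {W : ι → Subrepresentation π}
    (hW : DirectSum.IsInternal fun i => (W i).toSubmodule)
    (hirr : ∀ i, (W i).toRepresentation.IsIrreducible)
    (hne : Pairwise fun i j => IsEmpty ((W i).toRepresentation.Equiv (W j).toRepresentation))
    {p : ι → V →ₗ[k] V} (hp : ∀ i v, p i v ∈ (W i).toSubmodule)
    (hp1 : ∀ i, ∀ v ∈ (W i).toSubmodule, p i v = v)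
    (hp2 : ∀ i j, i ≠ j → ∀ v ∈ (W j).toSubmodule, p i v = 0)
    (hp0 : ∀ v, (∀ i, p i v = 0) → v = 0) (hpg : ∀ i g v, p i (π g v) = π g (p i v))
    (M : Subrepresentation π) {v : V} (hv : v ∈ M.toSubmodule) (i : ι) :
    p i v ∈ M.toSubmodule := by
  -- By semisimplicity `M` is the sum of its simple submodules, so only simple `S` inside `M` need
  -- be treated.
  have hss : IsSemisimpleModule (MonoidAlgebra k G) π.asModule := by
    refine isSemisimpleModule_of_isSemisimpleModule_submodule'
      (p := fun i => (W i).asSubmodule) (fun i => ?_) ?_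
    · have := (W i).isSimpleModule_asSubmodule_iff.2 (hirr i)
      infer_instance
    · rw [eq_top_iff]
      intro x _
      have hx : (x : V) ∈ ⨆ i, (W i).toSubmodule := by
        rw [hW.submodule_iSup_eq_top]
        trivial
      refine Submodule.iSup_induction _ (motive := fun x : V =>
        (x : π.asModule) ∈ ⨆ i, (W i).asSubmodule) hx ?_ ?_ ?_
      · exact fun j w hw => Submodule.mem_iSup_of_mem (p := fun i => (W i).asSubmodule) j hw
      · exact Submodule.zero_mem _
      · exact fun a b ha hb => Submodule.add_mem _ ha hb
  have hM := IsSemisimpleModule.sSup_simples_le M.asSubmodule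
  have hv' : (v : π.asModule) ∈ sSup {m : Submodule (MonoidAlgebra k G) π.asModule |
      IsSimpleModule (MonoidAlgebra k G) m ∧
      m ≤ M.asSubmodule} := by
    rw [hM]
    exact hv
  rw [sSup_eq_iSup'] at hv'
  refine Submodule.iSup_induction _ (motive := fun x : π.asModule =>
    p i (x : V) ∈ M.toSubmodule) hv' ?_ ?_ ?_
  · rintro ⟨S', hS', hS'M⟩ x hx
    obtain ⟨S, rfl⟩ := (Subrepresentation.subrepresentationSubmoduleOrderIso (ρ := π)).surjective S'
    have hSirr : S.toRepresentation.IsIrreducible := S.isSimpleModule_asSubmodule_iff.1 hS'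
    let q (j : ι) : S.toRepresentation.IntertwiningMap (W j).toRepresentation :=
      ⟨(p j).restrict (p := S.toSubmodule) (q := (W j).toSubmodule) fun v _ => hp j v, fun g =>
        LinearMap.ext fun v => Subtype.ext (hpg j g v)⟩
    suffices aux : ∀ y : V, y ∈ S.toSubmodule → p i y ∈ M.toSubmodule from aux x hx
    intro x hx
    have hqx : ∀ j, q j = 0 → p j x = 0 := fun j hj => by
      have h : q j ⟨x, hx⟩ = 0 := by rw [hj]; rfl
      exact congrArg Subtype.val h
    by_cases hi : q i = 0
    · rw [hqx i hi]
      exact M.toSubmodule.zero_mem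
    -- Two nonzero projections of `S` would be isomorphisms by Schur, making two summands
    -- equivalent. So `S` lies in the summand `i`.
    · have hj : ∀ j, j ≠ i → p j x = 0 := by
        intro j hji
        refine hqx j ?_
        by_contra hj
        have hirri := hirr i
        have hirrj := hirr j
        have bi := (Representation.IsIrreducible.bijective_or_eq_zero (q i)).resolve_right hi
        have bj := (Representation.IsIrreducible.bijective_or_eq_zero (q j)).resolve_right hj
        exact (hne hji).false (((q j).ofBijective bj).symm.trans ((q i).ofBijective bi))
      have : x - p i x = 0 := hp0 _ fun j => by
        rw [map_sub, sub_eq_zero]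
        rcases eq_or_ne j i with rfl | hji
        · rw [hp1 _ _ (hp j x)]
        · rw [hj j hji, hp2 _ _ hji _ (hp i x)]
      rw [← sub_eq_zero.1 this]
      exact hS'M hx
  · exact (map_zero (p i)).symm ▸ M.toSubmodule.zero_mem
  · intro x y hx hy
    exact (map_add (p i) x y) ▸ M.toSubmodule.add_mem hx hy

end Subrep

/-! ### Highest weight vectors lie in one summand -/

section HighestWeightComponent

variable {E : Type uE} [NormedAddCommGroup E] [NormedSpace ℝ E]
  {G : Type uG} [Group G] [TopologicalSpace G] [ChartedSpace E G]
  {V : Type uV} [AddCommGroup V] [Module ℂ V] {π : Representation ℂ G V}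

theorem IsSmoothRep.toRepresentation (hπ : IsSmoothRep E π) (W : Subrepresentation π) :
    IsSmoothRep E W.toRepresentation := by
  intro v ℓ
  obtain ⟨r, hr⟩ := LinearMap.exists_leftInverse_of_injective W.toSubmodule.subtype
    W.toSubmodule.ker_subtype
  have h : (fun g : G => ℓ (W.toRepresentation g v)) = fun g => (ℓ ∘ₗ r) (π g v) :=
    funext fun g => congrArg ℓ (DFunLike.congr_fun hr (W.toRepresentation g v)).symm
  rw [h]
  exact hπ _ _

variable [FiniteDimensional ℝ E] [LieGroup 𝓘(ℝ, E) ∞ G]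

/-- A highest weight vector `w` of a finite dimensional smooth representation lies in a
subrepresentation in which every vector of the same weight is a multiple of `w`. -/
theorem exists_subrepresentation_of_isHighestWeightVector [ConnectedSpace G]
    (P : PositiveRootData E G) [FiniteDimensional ℂ V] (hπ : IsSmoothRep E π) {w : V}
    (hw : IsHighestWeightVector P π w) :
    ∃ (wt : Module.Dual ℂ P.cartan) (M : Subrepresentation π), w ∈ M.toSubmodule ∧
      (∀ H : P.cartan, DerivedActionEq E π (H : ComplexLieAlgebra E G) w (wt H • w)) ∧
      ∀ u ∈ M.toSubmodule,
        (∀ H : P.cartan, DerivedActionEq E π (H : ComplexLieAlgebra E G) u (wt H • u)) →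
        u ∈ Submodule.span ℂ {w} := by
  obtain ⟨-, hpos, wt, hwt⟩ := hw
  let _ := derivedLieRingModule hπ
  have _ := derivedLieModule hπ
  have : FiniteDimensional ℝ (GroupLieAlgebra 𝓘(ℝ, E) G) := ‹FiniteDimensional ℝ E›
  let M := LieSubmodule.lieSpan ℂ (ComplexLieAlgebra E G) {w}
  refine ⟨wt, ⟨M.toSubmodule, fun g v hv => ?_⟩, LieSubmodule.subset_lieSpan rfl, hwt, ?_⟩
  · exact apply_mem_of_derivedVec_mem hπ M.toSubmodule
      (fun X v hv => M.lie_mem (x := (1 : ℂ) ⊗ₜ[ℝ] X) hv) g hv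
  · intro u hu huwt
    exact mem_span_singleton_of_mem_lieSpan_highestWeightVector P.regular
      (fun α hα X hX => (derivedActionEq_iff hπ).1 (hpos α hα X hX))
      (fun H => (derivedActionEq_iff hπ).1 (hwt H)) hu
      (fun H => (derivedActionEq_iff hπ).1 (huwt H))

/-- A highest weight vector in a multiplicity free direct sum of finite dimensional irreducible
representations lies in one of the summands. -/
theorem IsHighestWeightVector.exists_mem_summand [ConnectedSpace G]
    {P : PositiveRootData E G} (hπ : IsSmoothRep E π) {ι : Type*} [DecidableEq ι]
    {W : ι → Subrepresentation π} (hW : DirectSum.IsInternal fun i => (W i).toSubmodule)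
    (hfin : ∀ i, FiniteDimensional ℂ (W i).toSubmodule)
    (hirr : ∀ i, (W i).toRepresentation.IsIrreducible)
    (hne : Pairwise fun i j => IsEmpty ((W i).toRepresentation.Equiv (W j).toRepresentation))
    {w : V} (hw : IsHighestWeightVector P π w) : ∃ i, w ∈ (W i).toSubmodule := by
  obtain ⟨p, hp, hp1, hp2, hp0, hpg⟩ := exists_equivariant_projections hW
  have hwtop : w ∈ ⨆ i, (W i).toSubmodule := by
    rw [hW.submodule_iSup_eq_top]
    trivial
  obtain ⟨s, hs⟩ := (Submodule.mem_iSup_iff_exists_finset).1 hwtop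
  -- The whole space may be infinite dimensional; a finite subsum containing `w` makes the derived
  -- representation available.
  let U : Subrepresentation π := ⟨⨆ i ∈ s, (W i).toSubmodule, fun g v hv => by
    have h : (⨆ i ∈ s, (W i).toSubmodule) ≤ (⨆ i ∈ s, (W i).toSubmodule).comap (π g) :=
      iSup₂_le fun i hi x hx =>
        (le_iSup₂_of_le (f := fun i (_ : i ∈ s) => (W i).toSubmodule) i hi le_rfl)
          ((W i).apply_mem_toSubmodule g hx)
    exact h hv⟩
  have hUfin : FiniteDimensional ℂ U.toSubmodule := by
    have : U.toSubmodule = s.sup fun i => (W i).toSubmodule := (Finset.sup_eq_iSup _ _).symm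
    rw [this]
    infer_instance
  have hincl : ∀ g (u : U.toSubmodule),
      U.toSubmodule.subtype (U.toRepresentation g u) = π g (U.toSubmodule.subtype u) :=
    fun g u => rfl
  have hinj := U.toSubmodule.injective_subtype
  have hwU : IsHighestWeightVector P U.toRepresentation (⟨w, hs⟩ : U.toSubmodule) := by
    obtain ⟨h0, hpos, wt, hwt⟩ := hw
    refine ⟨fun h => h0 (congrArg Subtype.val h), fun α hα X hX => ?_, wt, fun H => ?_⟩
    · exact .of_map U.toSubmodule.subtype hincl hinj (hpos α hα X hX)
    · exact .of_map U.toSubmodule.subtype hincl hinj (hwt H)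
  obtain ⟨wt, M, hwM, hwt, hM⟩ :=
    exists_subrepresentation_of_isHighestWeightVector P (hπ.toRepresentation U) hwU
  let M' : Subrepresentation π := (U.toRepresentationOrderIso M).1
  have hwM' : w ∈ M'.toSubmodule := ⟨⟨w, hs⟩, hwM, rfl⟩
  obtain ⟨i, hi⟩ : ∃ i, p i w ≠ 0 := by
    by_contra! h
    exact hw.1 (hp0 w h)
  refine ⟨i, ?_⟩
  obtain ⟨u, hu, huw⟩ := component_mem_of_mem hW hirr hne hp hp1 hp2 hp0 hpg M' hwM' i
  -- Projections are equivariant, so the component of `w` keeps its weight.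
  have huwt : ∀ H : P.cartan,
      DerivedActionEq E U.toRepresentation (H : ComplexLieAlgebra E G) u (wt H • u) := by
    intro H
    refine .of_map U.toSubmodule.subtype hincl hinj ?_
    rw [map_smul, huw]
    have h := ((hwt H).map U.toSubmodule.subtype hincl).map (p i) (hpg i)
    rwa [map_smul, map_smul] at h
  obtain ⟨c, hc⟩ := Submodule.mem_span_singleton.1 (hM u hu huwt)
  have hc' : c • w = p i w := by
    rw [← huw, ← hc]
    rfl
  have hc0 : c ≠ 0 := by
    rintro rfl
    exact hi (by rw [← hc', zero_smul])
  have : w = c⁻¹ • p i w := by rw [← hc', inv_smul_smul₀ hc0]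
  rw [this]
  exact (W i).toSubmodule.smul_mem _ (hp i w)

end HighestWeightComponent

/-! ### Transport of irreducible subrepresentations -/

section SubrepMap

variable {k : Type*} {G : Type uG} [Field k] [Group G] {V : Type uV} [AddCommGroup V] [Module k V]
  {X : Type uW} [AddCommGroup X] [Module k X] {π : Representation k G V}
  {σ : Representation k G X}

/-- The image of a subrepresentation under an equivariant map. -/
def Subrepresentation.map (S : Subrepresentation π) (f : π.IntertwiningMap σ) :
    Subrepresentation σ where
  toSubmodule := S.toSubmodule.map f.toLinearMap
  apply_mem_toSubmodule := by
    rintro g _ ⟨v, hv, rfl⟩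
    exact ⟨π g v, S.apply_mem_toSubmodule g hv, f.isIntertwining _ _ g v⟩

/-- A subrepresentation is equivalent to its image under an injective equivariant map. -/
def Subrepresentation.equivMap (S : Subrepresentation π) (f : π.IntertwiningMap σ)
    (hf : Function.Injective f) : S.toRepresentation.Equiv (S.map f).toRepresentation :=
  .mk (Submodule.equivMapOfInjective f.toLinearMap hf S.toSubmodule) fun g =>
    LinearMap.ext fun v => Subtype.ext (f.isIntertwining _ _ g (v : V))

/-- The preimage of `K` is a nonzero subrepresentation of an irreducible one. Thus one vector drags
its whole summand along. -/
theorem Subrepresentation.le_of_apply_mem (S : Subrepresentation π)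
    (hS : S.toRepresentation.IsIrreducible) (f : S.toRepresentation.IntertwiningMap σ)
    (K : Subrepresentation σ) {v : S.toSubmodule} (hv : v ≠ 0) (hvK : f v ∈ K.toSubmodule)
    (w : S.toSubmodule) : f w ∈ K.toSubmodule := by
  let T : Subrepresentation S.toRepresentation :=
    ⟨K.toSubmodule.comap f.toLinearMap, fun g x hx => by
      have h := K.apply_mem_toSubmodule g (v := f x) hx
      rwa [← f.isIntertwining] at h⟩
  rcases hS.eq_bot_or_eq_top T with h | h
  · have : v ∈ T.toSubmodule := hvK
    rw [h] at this
    exact absurd ((Submodule.mem_bot k).1 this) hv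
  · have : w ∈ T.toSubmodule := by
      rw [h]
      exact Submodule.mem_top
    exact this

theorem Representation.Equiv.isIrreducible (e : π.Equiv σ) (h : π.IsIrreducible) :
    σ.IsIrreducible := by
  have hnt : Nontrivial (Subrepresentation σ) := by
    refine ⟨⟨⊥, ⊤, fun hbt => ?_⟩⟩
    have hX : ∀ x : X, x = 0 := fun x => by
      have : x ∈ (⊤ : Subrepresentation σ).toSubmodule := Submodule.mem_top
      rw [← hbt] at this
      exact (Submodule.mem_bot k).1 this
    apply (bot_ne_top (α := Subrepresentation π))
    apply Subrepresentation.toSubmodule_injective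
    refine (Submodule.eq_top_iff'.2 fun v => ?_)
    refine (Submodule.mem_bot k).2 (e.toLinearEquiv.injective ?_)
    rw [map_zero]
    exact hX _
  refine { eq_bot_or_eq_top := fun T => ?_ }
  let T' : Subrepresentation π :=
    ⟨T.toSubmodule.comap e.toLinearEquiv.toLinearMap, fun g v hv => by
      have h := T.apply_mem_toSubmodule g (v := e v) hv
      have h2 : e (π g v) = σ g (e v) := e.toIntertwiningMap.isIntertwining _ _ g v
      change e (π g v) ∈ T.toSubmodule
      rwa [h2]⟩
  rcases h.eq_bot_or_eq_top T' with h | h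
  · refine Or.inl (Subrepresentation.toSubmodule_injective ?_)
    refine (Submodule.eq_bot_iff _).2 fun x hx => ?_
    have hx' : e.toLinearEquiv.symm x ∈ T'.toSubmodule := by
      change e.toLinearEquiv (e.toLinearEquiv.symm x) ∈ T.toSubmodule
      rwa [LinearEquiv.apply_symm_apply]
    rw [h] at hx'
    exact e.toLinearEquiv.symm.map_eq_zero_iff.1 ((Submodule.mem_bot k).1 hx')
  · refine Or.inr (Subrepresentation.toSubmodule_injective ?_)
    refine Submodule.eq_top_iff'.2 fun x => ?_
    have hx' : e.toLinearEquiv.symm x ∈ T'.toSubmodule := by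
      rw [h]
      exact Submodule.mem_top
    have hx'' : e.toLinearEquiv (e.toLinearEquiv.symm x) ∈ T.toSubmodule := hx'
    rwa [LinearEquiv.apply_symm_apply] at hx''

/-- A nonzero finite dimensional subrepresentation contains an irreducible one. -/
theorem Subrepresentation.exists_le_isIrreducible (S : Subrepresentation σ)
    (hS : S.toSubmodule ≠ ⊥) [FiniteDimensional k S.toSubmodule] :
    ∃ T : Subrepresentation σ, T.toSubmodule ≤ S.toSubmodule ∧ T.toRepresentation.IsIrreducible := by
  obtain ⟨T, ⟨hTS, hT0⟩, hmin⟩ := WellFounded.has_min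
    (measure fun T : Subrepresentation σ => Module.finrank k T.toSubmodule).wf
    {T | T.toSubmodule ≤ S.toSubmodule ∧ T.toSubmodule ≠ ⊥} ⟨S, le_rfl, hS⟩
  refine ⟨T, hTS, T.isIrreducible_toRepresentation_iff.2
    ⟨fun h => hT0 (congrArg Subrepresentation.toSubmodule h), fun T' hT' => ?_⟩⟩
  by_contra hne
  have hlt : T'.toSubmodule < T.toSubmodule := hT'
  have : FiniteDimensional k T.toSubmodule := Submodule.finiteDimensional_of_le hTS
  exact hmin T' ⟨hlt.le.trans hTS, fun h => hne (Subrepresentation.toSubmodule_injective h)⟩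
    (Submodule.finrank_lt_finrank_of_lt hlt)

end SubrepMap

/-! ### Increasing chains of irreducibles and lim-irreducibility -/

section Chain

variable {G : ℕ → Type uG} [∀ n, Group (G n)]
  {φ : ∀ i j : ℕ, i ≤ j → G i →* G j} [DirectedSystem G (φ · · ·)]

variable (φ) in
/-- The canonical homomorphism from `G n` to the direct limit. -/
def toDirectLimit (n : ℕ) : G n →* DirectLimit G φ where
  toFun g := ⟦⟨n, g⟩⟧
  map_one' := (DirectLimit.one_def n).symm
  map_mul' g h := (DirectLimit.mul_def n g h).symm

theorem toDirectLimit_map {m n : ℕ} (h : m ≤ n) (g : G m) :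
    toDirectLimit φ n (φ m n h g) = toDirectLimit φ m g :=
  DirectLimit.mk_apply m n g h

variable {X : Type uW} [AddCommGroup X] [Module ℂ X]

/-- The representation of `G n` induced by a representation of the direct limit. -/
def stage (σ : Representation ℂ (DirectLimit G φ) X) (n : ℕ) : Representation ℂ (G n) X :=
  MonoidHom.comp σ (toDirectLimit φ n)

theorem stage_map (σ : Representation ℂ (DirectLimit G φ) X) {m n : ℕ} (h : m ≤ n) (g : G m) :
    stage σ n (φ m n h g) = stage σ m g :=
  congrArg σ (toDirectLimit_map h g)

variable {E : ℕ → Type uE} [∀ n, NormedAddCommGroup (E n)] [∀ n, NormedSpace ℝ (E n)]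
  [∀ n, TopologicalSpace (G n)] [∀ n, ChartedSpace (E n) (G n)]

/-- A representation of the direct limit is equivalent to the limit of a direct system if the
system embeds compatibly and exhausts it. -/
theorem RepSystem.nonempty_equiv_limitRep (S : RepSystem.{uG, uE, uV} E φ)
    {σ : Representation ℂ (DirectLimit G φ) X} (c : ∀ n, S.V n →ₗ[ℂ] X)
    (hc : ∀ i j h x, c j (S.map i j h x) = c i x) (hinj : ∀ n, Function.Injective (c n))
    (hsurj : ∀ y, ∃ n x, c n x = y)
    (heq : ∀ n g x, c n (S.rho n g x) = stage σ n g (c n x)) :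
    Nonempty (σ.Equiv S.limitRep) := by
  let l : S.Space →ₗ[ℂ] X := DirectLimit.Module.lift ℂ ℕ _ S.map c hc
  have hl : Function.Bijective l := by
    refine ⟨DirectLimit.lift_injective S.map (fun n x => c n x)
      (fun i j h x => (hc i j h x).symm) hinj, fun y => ?_⟩
    obtain ⟨n, x, rfl⟩ := hsurj y
    exact ⟨⟦⟨n, x⟩⟧, rfl⟩
  refine ⟨Representation.Equiv.symm
    (.mk (LinearEquiv.ofBijective l hl) fun g => LinearMap.ext fun x => ?_)⟩
  obtain ⟨i, a, rfl⟩ := DirectLimit.exists_eq_mk φ g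
  obtain ⟨j, y, rfl⟩ := DirectLimit.exists_eq_mk S.map x
  rw [← DirectLimit.mk_apply (f := S.map) j (max i j) y (le_max_right i j),
    ← DirectLimit.mk_apply (f := φ) i (max i j) a (le_max_left i j)]
  rw [LinearMap.comp_apply, LinearMap.comp_apply, S.limitRep_mk]
  exact heq _ _ _

variable (E) in
/-- The direct system formed by an increasing sequence of smooth subrepresentations of the
groups `G n`. -/
def RepSystem.ofMonotone {σ : Representation ℂ (DirectLimit G φ) X}
    (U : ∀ n, Subrepresentation (stage σ n)) (hmono : Monotone fun n => (U n).toSubmodule)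
    (hsmooth : ∀ n, IsSmoothRep (E n) (U n).toRepresentation) :
    RepSystem.{uG, uE, uW} E φ where
  V n := (U n).toSubmodule
  rho n := (U n).toRepresentation
  smooth := hsmooth
  map _ _ h := Submodule.inclusion (hmono h)
  directed := ⟨fun _ _ => rfl, fun _ _ _ _ _ _ => rfl⟩
  injective _ _ _ := Submodule.inclusion_injective _
  equivariant _ _ h g v := Subtype.ext
    (congrArg (fun f : X →ₗ[ℂ] X => f (v : X)) (stage_map σ h g).symm)

variable (E) in
/-- A representation which is exhausted by an increasing sequence of irreducible smooth
subrepresentations of the groups `G n` is lim-irreducible. -/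
theorem isLimIrreducible_of_monotone {σ : Representation ℂ (DirectLimit G φ) X}
    (B : Subrepresentation σ) (U : ∀ n, Subrepresentation (stage σ n))
    (hmono : Monotone fun n => (U n).toSubmodule)
    (hsmooth : ∀ n, IsSmoothRep (E n) (U n).toRepresentation)
    (hirr : ∀ n, (U n).toRepresentation.IsIrreducible)
    (hB : ∀ x, x ∈ B.toSubmodule ↔ ∃ n, x ∈ (U n).toSubmodule) :
    IsLimIrreducible E B.toRepresentation := by
  refine ⟨.ofMonotone E U hmono hsmooth, hirr, RepSystem.nonempty_equiv_limitRep _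
    (fun n => Submodule.inclusion fun x hx => (hB x).2 ⟨n, hx⟩) (fun i j h x => rfl)
    (fun n => Submodule.inclusion_injective _) (fun x => ?_) (fun n g x => rfl)⟩
  obtain ⟨n, hn⟩ := (hB x.1).1 x.2
  exact ⟨n, ⟨x.1, hn⟩, rfl⟩

/-- Smoothness passes to subrepresentations of smaller groups. -/
theorem isSmoothRep_stage_of_le (hφ : ∀ i j h, ContMDiff 𝓘(ℝ, E i) 𝓘(ℝ, E j) ∞ (φ i j h))
    {σ : Representation ℂ (DirectLimit G φ) X} {m n : ℕ} (h : m ≤ n)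
    (T : Subrepresentation (stage σ m)) (U : Subrepresentation (stage σ n))
    (hTU : T.toSubmodule ≤ U.toSubmodule) (hU : IsSmoothRep (E n) U.toRepresentation) :
    IsSmoothRep (E m) T.toRepresentation := by
  intro v ℓ
  obtain ⟨r, hr⟩ := LinearMap.exists_leftInverse_of_injective (Submodule.inclusion hTU)
    (LinearMap.ker_eq_bot.2 (Submodule.inclusion_injective hTU))
  have heq : (fun g : G m => ℓ (T.toRepresentation g v)) =
      (fun g : G n => (ℓ ∘ₗ r) (U.toRepresentation g (Submodule.inclusion hTU v))) ∘
        φ m n h := by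
    funext g
    have h1 : U.toRepresentation (φ m n h g) (Submodule.inclusion hTU v) =
        Submodule.inclusion hTU (T.toRepresentation g v) :=
      Subtype.ext (congrArg (fun f : X →ₗ[ℂ] X => f (v : X)) (stage_map σ h g))
    simp only [Function.comp_apply, LinearMap.comp_apply, h1]
    exact congrArg ℓ (DFunLike.congr_fun hr _).symm
  rw [heq]
  exact (hU _ _).comp (hφ m n h)

variable (E) in
/-- The conditions on a sequence of subspaces, from the index `k` on, to be an increasing sequence
of finite dimensional irreducible smooth subrepresentations. -/
def IsIrreducibleChain {σ : Representation ℂ (DirectLimit G φ) X}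
    (U : ∀ n, Subrepresentation (stage σ n)) (k : ℕ) : Prop :=
  ∀ n, k ≤ n → (U n).toSubmodule ≤ (U (n + 1)).toSubmodule ∧
    IsSmoothRep (E n) (U n).toRepresentation ∧ (U n).toRepresentation.IsIrreducible ∧
    FiniteDimensional ℂ (U n).toSubmodule

/-- Lim-irreducibility asks for an irreducible representation at every level, also below the start
of the chain. Going down, the next term restricted to the smaller group is nonzero and finite
dimensional, so it contains an irreducible; any choice leaves the union unchanged. -/
theorem IsIrreducibleChain.exists_extend
    (hφ : ∀ i j h, ContMDiff 𝓘(ℝ, E i) 𝓘(ℝ, E j) ∞ (φ i j h))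
    {σ : Representation ℂ (DirectLimit G φ) X} (k : ℕ)
    {U : ∀ n, Subrepresentation (stage σ n)} (hU : IsIrreducibleChain E U k) :
    ∃ U' : ∀ n, Subrepresentation (stage σ n), IsIrreducibleChain E U' 0 ∧
      ∀ n, k ≤ n → U' n = U n := by
  induction k generalizing U with
  | zero => exact ⟨U, hU, fun _ _ => rfl⟩
  | succ k ih =>
    obtain ⟨-, hs, hirr, hfin⟩ := hU (k + 1) le_rfl
    let R : Subrepresentation (stage σ k) := ⟨(U (k + 1)).toSubmodule, fun g v hv => by
      rw [← stage_map σ k.le_succ g]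
      exact (U (k + 1)).apply_mem_toSubmodule _ hv⟩
    have hR : R.toSubmodule ≠ ⊥ := fun h =>
      ((U (k + 1)).isIrreducible_toRepresentation_iff.1 hirr).1
        (Subrepresentation.toSubmodule_injective h)
    have hRfin : FiniteDimensional ℂ R.toSubmodule := hfin
    obtain ⟨T, hTR, hT⟩ := R.exists_le_isIrreducible hR
    have hTs := isSmoothRep_stage_of_le hφ k.le_succ T (U (k + 1)) hTR hs
    have hchain : IsIrreducibleChain E (Function.update U k T) k := by
      intro n hn
      rcases hn.eq_or_lt with rfl | hn
      · rw [Function.update_self, Function.update_of_ne (Nat.succ_ne_self k)]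
        exact ⟨hTR, hTs, hT, Submodule.finiteDimensional_of_le hTR⟩
      · rw [Function.update_of_ne hn.ne', Function.update_of_ne (hn.trans n.lt_succ_self).ne']
        exact hU n hn
    obtain ⟨U', hU', h⟩ := ih hchain
    refine ⟨U', hU', fun n hn => ?_⟩
    rw [h n (k.le_succ.trans hn), Function.update_of_ne (Nat.lt_of_succ_le hn).ne']

theorem IsIrreducibleChain.isLimIrreducible
    (hφ : ∀ i j h, ContMDiff 𝓘(ℝ, E i) 𝓘(ℝ, E j) ∞ (φ i j h))
    {σ : Representation ℂ (DirectLimit G φ) X} {k : ℕ}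
    {U : ∀ n, Subrepresentation (stage σ n)} (hU : IsIrreducibleChain E U k)
    (B : Subrepresentation σ)
    (hB : ∀ x, x ∈ B.toSubmodule ↔ ∃ n, k ≤ n ∧ x ∈ (U n).toSubmodule) :
    IsLimIrreducible E B.toRepresentation := by
  obtain ⟨U', hU', h⟩ := hU.exists_extend hφ
  have hmono : Monotone fun n => (U' n).toSubmodule :=
    monotone_nat_of_le_succ fun n => (hU' n n.zero_le).1
  refine isLimIrreducible_of_monotone E B U' hmono (fun n => (hU' n n.zero_le).2.1)
    (fun n => (hU' n n.zero_le).2.2.1) fun x => ?_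
  rw [hB]
  constructor
  · rintro ⟨n, hn, hx⟩
    exact ⟨n, by rwa [h n hn]⟩
  · rintro ⟨n, hx⟩
    refine ⟨max k n, le_max_left k n, ?_⟩
    rw [← h _ (le_max_left k n)]
    exact hmono (le_max_right k n) hx

end Chain

/-! ### Decomposition of the limit into unions of branches -/

section LimitDecomposition

variable {E : ℕ → Type uE} [∀ n, NormedAddCommGroup (E n)] [∀ n, NormedSpace ℝ (E n)]
  {G : ℕ → Type uG} [∀ n, Group (G n)] [∀ n, TopologicalSpace (G n)]
  [∀ n, ChartedSpace (E n) (G n)]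
  {φ : ∀ i j : ℕ, i ≤ j → G i →* G j} [DirectedSystem G (φ · · ·)]
  {X : Type uV} [AddCommGroup X] [Module ℂ X]

/-- If a representation of the direct limit is exhausted by multiplicity free sums of irreducible
representations of the `G n`, and each summand for `G n` lies in a summand for `G (n + 1)`, then it
is a multiplicity free sum of lim-irreducible representations. -/
theorem isMultiplicityFreeSum_of_summands_le
    (hφ : ∀ i j h, ContMDiff 𝓘(ℝ, E i) 𝓘(ℝ, E j) ∞ (φ i j h))
    {σ : Representation ℂ (DirectLimit G φ) X} (N : ℕ) {ι : ℕ → Type uV}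
    (A : ∀ n, ι n → Subrepresentation (stage σ n))
    (hindep : ∀ n, iSupIndep fun i => (A n i).toSubmodule)
    (hcover : ∀ x : X, ∃ n, N ≤ n ∧ x ∈ ⨆ i, (A n i).toSubmodule)
    (hsmooth : ∀ n i, IsSmoothRep (E n) (A n i).toRepresentation)
    (hirr : ∀ n i, (A n i).toRepresentation.IsIrreducible)
    (hfin : ∀ n i, FiniteDimensional ℂ (A n i).toSubmodule)
    (hne : ∀ n, Pairwise fun i j =>
      IsEmpty ((A n i).toRepresentation.Equiv (A n j).toRepresentation))
    (hstep : ∀ n, N ≤ n → ∀ i, ∃ j, (A n i).toSubmodule ≤ (A (n + 1) j).toSubmodule) :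
    IsMultiplicityFreeSum σ (IsLimIrreducible E) := by
  classical
  have hA0 : ∀ n i, (A n i).toSubmodule ≠ ⊥ := fun n i h =>
    ((A n i).isIrreducible_toRepresentation_iff.1 (hirr n i)).1
      (Subrepresentation.toSubmodule_injective h)
  have huniq : ∀ n i m j j', (A n i).toSubmodule ≤ (A m j).toSubmodule →
      (A n i).toSubmodule ≤ (A m j').toSubmodule → j = j' := by
    intro n i m j j' h h'
    by_contra hjj
    exact hA0 n i (le_bot_iff.1 (((hindep m).pairwiseDisjoint hjj).le_bot.trans' (le_inf h h')))
  have hlift : ∀ p : (Σ n : {n // N ≤ n}, ι n), ∀ m, p.1.1 ≤ m →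
      ∃ j, (A p.1 p.2).toSubmodule ≤ (A m j).toSubmodule := by
    intro p m hm
    induction m, hm using Nat.le_induction with
    | base => exact ⟨p.2, le_rfl⟩
    | succ m hm ih =>
      obtain ⟨j, hj⟩ := ih
      obtain ⟨j', hj'⟩ := hstep m (p.1.2.trans hm) j
      exact ⟨j', hj.trans hj'⟩
  -- By `huniq` the index is forced, so the choices at different levels agree with each other.
  choose t ht using hlift
  have htmono : ∀ p m (hm : p.1.1 ≤ m) m' (hm' : p.1.1 ≤ m'), m ≤ m' →
      (A m (t p m hm)).toSubmodule ≤ (A m' (t p m' hm')).toSubmodule := by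
    intro p m hm m' hm' hmm'
    have h := ht ⟨⟨m, p.1.2.trans hm⟩, t p m hm⟩ m' hmm'
    rwa [huniq _ _ _ _ _ ((ht p m hm).trans h) (ht p m' hm')] at h
  have hteq : ∀ p q m (hp : p.1.1 ≤ m) (hq : q.1.1 ≤ m) m' (hp' : p.1.1 ≤ m') (hq' : q.1.1 ≤ m'),
      m ≤ m' → t p m hp = t q m hq → t p m' hp' = t q m' hq' := by
    intro p q m hp hq m' hp' hq' hmm' heq
    refine huniq m (t p m hp) m' _ _ (htmono p m hp m' hp' hmm') ?_
    rw [heq]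
    exact htmono q m hq m' hq' hmm'
  -- The union of the branch that starts at `p`.
  let B (p : Σ n : {n // N ≤ n}, ι n) : Subrepresentation σ :=
    { toSubmodule :=
        { carrier := {x | ∃ m, ∃ h : p.1.1 ≤ m, x ∈ (A m (t p m h)).toSubmodule}
          zero_mem' := ⟨p.1.1, le_rfl, Submodule.zero_mem _⟩
          add_mem' := by
            rintro x y ⟨m, hm, hx⟩ ⟨m', hm', hy⟩
            have h := hm.trans (le_max_left m m')
            exact ⟨max m m', h, Submodule.add_mem _
              (htmono p m hm _ h (le_max_left m m') hx)
              (htmono p m' hm' _ h (le_max_right m m') hy)⟩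
          smul_mem' := by
            rintro c x ⟨m, hm, hx⟩
            exact ⟨m, hm, Submodule.smul_mem _ c hx⟩ }
      apply_mem_toSubmodule := by
        rintro g x ⟨m, hm, hx⟩
        obtain ⟨k, a, rfl⟩ := DirectLimit.exists_eq_mk φ g
        have h := hm.trans (le_max_left m k)
        refine ⟨max m k, h, ?_⟩
        rw [← DirectLimit.mk_apply (f := φ) k (max m k) a (le_max_right m k)]
        exact (A _ _).apply_mem_toSubmodule (φ k (max m k) (le_max_right m k) a)
          (htmono p m hm _ h (le_max_left m k) hx) }
  have hBlarge : ∀ p x, x ∈ (B p).toSubmodule → ∃ m₀, ∀ m, m₀ ≤ m → ∀ h : p.1.1 ≤ m,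
      x ∈ (A m (t p m h)).toSubmodule := by
    rintro p x ⟨m, hm, hx⟩
    exact ⟨m, fun m' hmm' h => htmono p m hm m' h hmm' hx⟩
  have hBle : ∀ p q m (hp : p.1.1 ≤ m) (hq : q.1.1 ≤ m), t p m hp = t q m hq →
      (B p).toSubmodule ≤ (B q).toSubmodule := by
    intro p q m hp hq heq x hx
    obtain ⟨m₀, hm₀⟩ := hBlarge p x hx
    have hp' := hp.trans (le_max_left m m₀)
    have hq' := hq.trans (le_max_left m m₀)
    refine ⟨max m m₀, hq', ?_⟩
    rw [← hteq p q m hp hq _ hp' hq' (le_max_left _ _) heq]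
    exact hm₀ _ (le_max_right _ _) hp'
  have hBeq : ∀ p q m (hp : p.1.1 ≤ m) (hq : q.1.1 ≤ m), t p m hp = t q m hq → B p = B q :=
    fun p q m hp hq heq => Subrepresentation.toSubmodule_injective
      (le_antisymm (hBle p q m hp hq heq) (hBle q p m hq hp heq.symm))
  have hBlim : ∀ p, IsLimIrreducible E (B p).toRepresentation := by
    intro p
    let U (m : ℕ) : Subrepresentation (stage σ m) :=
      if h : p.1.1 ≤ m then A m (t p m h) else ⊥
    have hU : ∀ m (h : p.1.1 ≤ m), U m = A m (t p m h) := fun m h => dif_pos h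
    have hchain : IsIrreducibleChain E U p.1.1 := by
      intro m hm
      rw [hU m hm, hU (m + 1) (hm.trans m.le_succ)]
      exact ⟨htmono p m hm _ _ m.le_succ, hsmooth _ _, hirr _ _, hfin _ _⟩
    refine hchain.isLimIrreducible hφ (B p) fun x => ?_
    constructor
    · rintro ⟨m, hm, hx⟩
      exact ⟨m, hm, by rwa [hU m hm]⟩
    · rintro ⟨m, hm, hx⟩
      exact ⟨m, hm, by rwa [hU m hm] at hx⟩
  -- Indexing by the range of `B`, not by starting points, counts branches that eventually meet only
  -- once.
  refine ⟨Set.range B, inferInstance, Subtype.val, ?_, ?_, ?_⟩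
  · refine DirectSum.isInternal_submodule_of_iSupIndep_of_iSup_eq_top ?_ ?_
    · rw [iSupIndep_iff_finsetSum_eq_zero_imp_eq_zero]
      intro s v hv hsum
      choose rep hrep using fun b : Set.range B => b.2
      have hv' : ∀ b, ∃ m₀, b ∈ s → ∀ m, m₀ ≤ m → ∀ h : (rep b).1.1 ≤ m,
          v b ∈ (A m (t (rep b) m h)).toSubmodule := by
        intro b
        by_cases hb : b ∈ s
        · have h := hv b hb
          rw [← hrep b] at h
          obtain ⟨m₀, hm₀⟩ := hBlarge _ _ h
          exact ⟨m₀, fun _ => hm₀⟩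
        · exact ⟨0, fun h => absurd h hb⟩
      choose m₀ hm₀ using hv'
      -- A level where all the branches involved have started and contain their terms. Distinct
      -- unions have distinct summands there, so independence at this level suffices.
      let m := s.sup fun b => max (m₀ b) (rep b).1.1
      have hm : ∀ b ∈ s, max (m₀ b) (rep b).1.1 ≤ m := fun b hb =>
        Finset.le_sup (f := fun b => max (m₀ b) ((rep b).1.1 : ℕ)) hb
      have hm1 : ∀ b ∈ s, m₀ b ≤ m := fun b hb => (le_max_left _ _).trans (hm b hb)
      have hm2 : ∀ b ∈ s, (rep b).1.1 ≤ m := fun b hb => (le_max_right _ _).trans (hm b hb)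
      let τ (b : s) : ι m := t (rep b) m (hm2 b b.2)
      have hτ : Function.Injective τ := by
        intro b b' h
        have := hBeq _ _ m _ _ h
        rw [hrep, hrep] at this
        exact Subtype.ext (Subtype.ext this)
      have hind := (hindep m).comp hτ
      rw [iSupIndep_iff_finsetSum_eq_zero_imp_eq_zero] at hind
      intro b hb
      refine hind Finset.univ (fun b => v b) (fun b _ => hm₀ b b.2 m (hm1 b b.2) _) ?_ ⟨b, hb⟩
        (Finset.mem_univ _)
      rw [← hsum]
      exact Finset.sum_coe_sort s v
    · rw [eq_top_iff]
      intro x _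
      obtain ⟨n, hn, hx⟩ := hcover x
      refine (iSup_le fun i => ?_ :
        ⨆ i, (A n i).toSubmodule ≤ ⨆ b : Set.range B, b.1.toSubmodule) hx
      let p : Σ n : {n // N ≤ n}, ι n := ⟨⟨n, hn⟩, i⟩
      refine le_iSup_of_le (⟨B p, p, rfl⟩ : Set.range B) fun y hy => ?_
      exact ⟨n, le_rfl, ht p n le_rfl hy⟩
  · rintro ⟨_, p, rfl⟩
    exact hBlim p
  · rintro ⟨_, p, rfl⟩ ⟨_, q, rfl⟩ hpq
    refine ⟨fun e => hpq (Subtype.ext ?_)⟩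
    change B p = B q
    -- At a late level `m`, the image of `x` lies in the summand of `q`. By irreducibility the whole
    -- summand of `p` is then mapped there, and Schur applies.
    obtain ⟨x, hx, hx0⟩ := Submodule.exists_mem_ne_zero_of_ne_bot (hA0 _ p.2)
    have hxB : x ∈ (B p).toSubmodule := ⟨p.1.1, le_rfl, ht p _ le_rfl hx⟩
    change (B p).toRepresentation.Equiv (B q).toRepresentation at e
    obtain ⟨m₀, hm₀⟩ := hBlarge q _ (e ⟨x, hxB⟩).2
    let m := max m₀ (max p.1.1 q.1.1)
    have hpm : p.1.1 ≤ m := (le_max_left _ _).trans (le_max_right _ _)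
    have hqm : q.1.1 ≤ m := (le_max_right _ _).trans (le_max_right _ _)
    refine hBeq p q m hpm hqm ?_
    by_contra htne
    have hAB : (A m (t p m hpm)).toSubmodule ≤ (B p).toSubmodule := fun y hy => ⟨m, hpm, hy⟩
    let f : (A m (t p m hpm)).toRepresentation.IntertwiningMap (stage σ m) :=
      ⟨(B q).toSubmodule.subtype ∘ₗ e.toLinearEquiv.toLinearMap ∘ₗ Submodule.inclusion hAB,
        fun g => LinearMap.ext fun y => congrArg Subtype.val
          (e.toIntertwiningMap.isIntertwining _ _ (toDirectLimit φ m g)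
            (Submodule.inclusion hAB y))⟩
    have hxA : x ∈ (A m (t p m hpm)).toSubmodule := ht p m hpm hx
    have hmem := (A m (t p m hpm)).le_of_apply_mem (hirr _ _) f (A m (t q m hqm))
      (v := ⟨x, hxA⟩) (fun h => hx0 (congrArg Subtype.val h))
      (hm₀ m (le_max_left _ _) hqm)
    let f' : (A m (t p m hpm)).toRepresentation.IntertwiningMap
        (A m (t q m hqm)).toRepresentation :=
      ⟨f.toLinearMap.codRestrict _ hmem, fun g => LinearMap.ext fun y => Subtype.ext
        (f.isIntertwining _ _ g y)⟩
    have hp' := hirr m (t p m hpm)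
    have hq' := hirr m (t q m hqm)
    rcases Representation.IsIrreducible.bijective_or_eq_zero f' with h | h
    · exact (hne m htne).false (f'.ofBijective h)
    · have h1 : f' ⟨x, hxA⟩ = 0 := by rw [h]; rfl
      have h1' : (f' ⟨x, hxA⟩ : X) = 0 := congrArg Subtype.val h1
      have h2 : e.toLinearEquiv ⟨x, hxB⟩ = 0 := Subtype.ext h1'
      rw [e.toLinearEquiv.map_eq_zero_iff] at h2
      exact hx0 (congrArg Subtype.val h2)

end LimitDecomposition

/-! ### From the direct system to its limit, and the theorem -/

section MainTheorem

variable {E : ℕ → Type uE} [∀ n, NormedAddCommGroup (E n)] [∀ n, NormedSpace ℝ (E n)]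
  {G : ℕ → Type uG} [∀ n, Group (G n)] [∀ n, TopologicalSpace (G n)]
  [∀ n, ChartedSpace (E n) (G n)]
  {φ : ∀ i j : ℕ, i ≤ j → G i →* G j} [DirectedSystem G (φ · · ·)]

/-- The canonical equivariant map from a term of a direct system of representations to the
limit. -/
def RepSystem.toLimit (S : RepSystem.{uG, uE, uV} E φ) (n : ℕ) :
    (S.rho n).IntertwiningMap (stage S.limitRep n) :=
  ⟨DirectLimit.Module.of ℂ ℕ S.V S.map n, fun g => LinearMap.ext fun v =>
    (S.limitRep_mk n g v).symm⟩

theorem RepSystem.toLimit_injective (S : RepSystem.{uG, uE, uV} E φ) (n : ℕ) :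
    Function.Injective (S.toLimit n) :=
  DirectLimit.mk_injective S.map S.injective n

theorem RepSystem.toLimit_map (S : RepSystem.{uG, uE, uV} E φ) {m n : ℕ} (h : m ≤ n) (v : S.V m) :
    S.toLimit n (S.map m n h v) = S.toLimit m v :=
  DirectLimit.mk_apply (f := S.map) m n v h

theorem IsSmoothRep.of_equiv {E : Type uE} [NormedAddCommGroup E] [NormedSpace ℝ E]
    {G : Type uG} [Group G] [TopologicalSpace G] [ChartedSpace E G]
    {V : Type uV} [AddCommGroup V] [Module ℂ V] {X : Type uW} [AddCommGroup X] [Module ℂ X]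
    {π : Representation ℂ G V} {σ : Representation ℂ G X} (hπ : IsSmoothRep E π)
    (e : σ.Equiv π) : IsSmoothRep E σ := by
  intro x ℓ
  have h : (fun g : G => ℓ (σ g x)) =
      fun g => (ℓ ∘ₗ e.toLinearEquiv.symm.toLinearMap) (π g (e x)) := by
    funext g
    have h1 : e (σ g x) = π g (e x) := e.toIntertwiningMap.isIntertwining _ _ g x
    rw [← h1]
    exact congrArg ℓ (e.toLinearEquiv.symm_apply_apply _).symm
  rw [h]
  exact hπ _ _

/-- If each irreducible summand at level `n ≥ N` is mapped into an irreducible summand at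
level `n + 1`, then the limit is a multiplicity free sum of lim-irreducible representations. -/
theorem RepSystem.isMultiplicityFreeSum_limitRep
    (hφ : ∀ i j h, ContMDiff 𝓘(ℝ, E i) 𝓘(ℝ, E j) ∞ (φ i j h))
    (S : RepSystem.{uG, uE, uV} E φ) (N : ℕ) {ι : ℕ → Type uV} [∀ n, DecidableEq (ι n)]
    (W : ∀ n, ι n → Subrepresentation (S.rho n))
    (hW : ∀ n, DirectSum.IsInternal fun i => (W n i).toSubmodule)
    (hirr : ∀ n i, (W n i).toRepresentation.IsIrreducible)
    (hfin : ∀ n i, FiniteDimensional ℂ (W n i).toSubmodule)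
    (hne : ∀ n, Pairwise fun i j =>
      IsEmpty ((W n i).toRepresentation.Equiv (W n j).toRepresentation))
    (hstep : ∀ n, N ≤ n → ∀ i, ∃ j, ∀ v ∈ (W n i).toSubmodule,
      S.map n (n + 1) n.le_succ v ∈ (W (n + 1) j).toSubmodule) :
    IsMultiplicityFreeSum S.limitRep (IsLimIrreducible E) := by
  let e (n : ℕ) (i : ι n) := (W n i).equivMap (S.toLimit n) (S.toLimit_injective n)
  refine isMultiplicityFreeSum_of_summands_le hφ N (fun n i => (W n i).map (S.toLimit n))
    (fun n => ?_) (fun x => ?_) (fun n i => ?_) (fun n i => (e n i).isIrreducible (hirr n i))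
    (fun n i => ?_) (fun n i j hij => ⟨fun f => ?_⟩) fun n hn i => ?_
  · exact (S.toLimit n).toLinearMap.iSupIndep_map (S.toLimit_injective n)
      (hW n).submodule_iSupIndep
  · obtain ⟨n, v, rfl⟩ := DirectLimit.exists_eq_mk S.map x
    refine ⟨max n N, le_max_right n N, ?_⟩
    have hv : S.map n _ (le_max_left n N) v ∈ ⨆ i, (W (max n N) i).toSubmodule := by
      rw [(hW (max n N)).submodule_iSup_eq_top]
      exact Submodule.mem_top
    have := Submodule.mem_map_of_mem (f := (S.toLimit (max n N)).toLinearMap) hv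
    rw [Submodule.map_iSup] at this
    change S.toLimit n v ∈ _
    rw [← S.toLimit_map (le_max_left n N)]
    exact this
  · exact ((S.smooth n).toRepresentation (W n i)).of_equiv (e n i).symm
  · have := hfin n i
    exact (e n i).toLinearEquiv.finiteDimensional
  · exact (hne n hij).false (((e n i).trans f).trans (e n j).symm)
  · obtain ⟨j, hj⟩ := hstep n hn i
    refine ⟨j, ?_⟩
    rintro _ ⟨v, hv, rfl⟩
    exact ⟨_, hj v hv, S.toLimit_map n.le_succ v⟩

end MainTheorem

end

theorem mainTheorem2
    {E : ℕ → Type uE} [∀ n, NormedAddCommGroup (E n)] [∀ n, NormedSpace ℝ (E n)]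
    [∀ n, FiniteDimensional ℝ (E n)]
    {G : ℕ → Type uG} [∀ n, Group (G n)] [∀ n, TopologicalSpace (G n)]
    [∀ n, ChartedSpace (E n) (G n)] [∀ n, LieGroup 𝓘(ℝ, E n) ∞ (G n)] [∀ n, ConnectedSpace (G n)]
    {φ : ∀ i j : ℕ, i ≤ j → G i →* G j} [DirectedSystem G (φ · · ·)]
    (hφ : ∀ i j h, ContMDiff 𝓘(ℝ, E i) 𝓘(ℝ, E j) ∞ (φ i j h))
    (P : ∀ n, PositiveRootData (E n) (G n))
    (S : RepSystem.{uG, uE, uV} E φ)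
    (hsum : ∀ n, IsMultiplicityFreeSum (S.rho n) (IsIrreducibleHighestWeightRep (P n)))
    (hvec : ∃ N : ℕ, ∀ n ≥ N, ∀ v : S.V n, IsHighestWeightVector (P n) (S.rho n) v →
      IsHighestWeightVector (P (n + 1)) (S.rho (n + 1)) (S.map n (n + 1) n.le_succ v)) :
    IsMultiplicityFreeSum S.limitRep (IsLimIrreducible E) := by
  choose ι hι W hW hQ hne using hsum
  obtain ⟨N, hN⟩ := hvec
  have hirr : ∀ n i, (W n i).toRepresentation.IsIrreducible := fun n i => (hQ n i).2.2.1
  have hfin : ∀ n i, FiniteDimensional ℂ (W n i).toSubmodule := fun n i => (hQ n i).2.1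
  refine S.isMultiplicityFreeSum_limitRep hφ N W hW hirr hfin hne fun n hn i => ?_
  obtain ⟨v, hv0, hpos, wt, hwt⟩ := (hQ n i).2.2.2
  have hincl : ∀ g (u : (W n i).toSubmodule), (W n i).toSubmodule.subtype
      ((W n i).toRepresentation g u) = S.rho n g ((W n i).toSubmodule.subtype u) :=
    fun g u => rfl
  have hv : IsHighestWeightVector (P n) (S.rho n) (v : S.V n) :=
    ⟨fun h => hv0 (Subtype.ext h),
      fun α hα Y hY => by
        simpa using (hpos α hα Y hY).map (W n i).toSubmodule.subtype hincl,
      wt, fun H => (hwt H).map (W n i).toSubmodule.subtype hincl⟩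
  obtain ⟨j, hj⟩ := (hN n hn v hv).exists_mem_summand (S.smooth (n + 1)) (hW (n + 1))
    (hfin (n + 1)) (hirr (n + 1)) (hne (n + 1))
  refine ⟨j, fun w hw => ?_⟩
  -- The preimage of the summand `j`; it contains the highest weight vector `v` and hence all of the
  -- irreducible `W n i`.
  let K : Subrepresentation (S.rho n) :=
    ⟨(W (n + 1) j).toSubmodule.comap (S.map n (n + 1) n.le_succ), fun g x hx => by
      rw [Submodule.mem_comap, S.equivariant]
      exact (W (n + 1) j).apply_mem_toSubmodule _ hx⟩
  exact (W n i).le_of_apply_mem (hirr n i) ⟨(W n i).toSubmodule.subtype, fun g => rfl⟩ K hv0 hj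
    ⟨w, hw⟩
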